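/- Let $n\ge 2$ and let $\Omega\subset\mathbb R^n$ be a bounded domain with $C^\infty$ boundary and unit outer normal $n(x)$, and put $\Gamma_\pm=\{(x,v)\in\partial\Omega\times\mathbb R^n:\ \pm\, n(x)\cdot v>0\}$ and $\tau_\pm(x,v)=\sup\{s\ge 0:\ x\pm sv\in\Omega\}$ for $v\neq 0$ (with $\sup\emptyset=0$). For a kernel $B\in C(\mathbb R^n\times\mathbb R^n\times\mathbb S^{n-1})$ consider the boundary value problem $$v\cdot\nabla_xF=\int_{\mathbb R^n}\int_{\mathbb S^{n-1}}B(v,u,\omega)\,[F(x,u')F(x,v')-F(x,u)F(x,v)]\,d\omega\,du\ \text{ in }\Omega\times\mathbb R^n,\qquad F=g\ \text{ on }\Gamma_-,$$ where $u'=u-[(u-v)\cdot\omega]\omega$ and $v'=v+[(u-v)\cdot\omega]\omega$. Solutions are bounded measurable functions $F$ that satisfy the equation, for $v\ne0$, in integrated form along the characteristics $s\mapsto(x+sv,v)$ in $\Omega$ and attain the value $g$ on $\Gamma_-$ along them. Let $B_1,B_2\in C(\mathbb R^n\times\mathbb R^n\times\mathbb S^{n-1})$ be two kernels such that, for $j=1,2$: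 (a) there is $M>0$ with $\tau_\pm(x,v)\int_{\mathbb R^n}\int_{\mathbb S^{n-1}}|B_j(v,u,\omega)|\,d\omega\,du<M$ for all $x\in\overline\Omega$ and $v\in\mathbb R^n\setminus\{0\}$; (b) $B_j(v,u,\omega)=B_j(u,v,\omega)$ and $B_j(v,u,-\omega)=B_j(v,u,\omega)$ for all $v,u\in\mathbb R^n$, $\omega\in\mathbb S^{n-1}$. Suppose that $B_1$ and $B_2$ have identical boundary measurements for small data: there are $\varepsilon,\delta>0$ such that for every continuous $g$ on $\Gamma_-$ with $|g|\le\varepsilon$, and all solutions $F_1,F_2$ of the problem with datum $g$ and kernels $B_1,B_2$ respectively that satisfy $|F_j|\le\delta$, the outgoing traces $\lim_{t\downarrow0}F_j(x-tv,v)$, $j=1,2$, coincide at every $(x,v)\in\Gamma_+$ whose backward trajectory in $\Omega$ starts at a point of $\Gamma_-$ (for convex $\Omega$ these are all points of $\Gamma_+$; in general only trajectories that enter $\Omega$ tangentially are left out). Then $B_1=B_2$ everywhere on $\mathbb R^n\times\mathbb R^n\times\mathbb S^{n-1}$ in each of the following two cases: 1. $B_1$ and $B_2$ are both independent of $\omega$;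 2. $B_1\ge B_2$ pointwise. -/

import Mathlib

open MeasureTheory Set Filter Topology
open scoped ENNReal

namespace Boltzmann

/-- Position and velocity space `ℝⁿ` with its Euclidean norm. -/
abbrev Space (n : ℕ) : Type := EuclideanSpace ℝ (Fin n)

/-- The unit sphere `𝕊ⁿ⁻¹`. -/
abbrev USphere (n : ℕ) : Type := Metric.sphere (0 : Space n) 1

/-- A collision kernel `B(v, u, ω)`. -/
abbrev Kernel (n : ℕ) : Type := Space n → Space n → USphere n → ℝ

/-- The surface measure `dω` on `𝕊ⁿ⁻¹`. -/
noncomputable def sphereMeasure (n : ℕ) : Measure (USphere n) :=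
  (volume : Measure (Space n)).toSphere

/-! ### The domain, its boundary and the exit times -/

/-- `ρ` is a smooth defining function of `Ω` on the open neighbourhood `U` of `x`: it has no
critical point in `U`, and `Ω ∩ U = {ρ < 0} ∩ U`. -/
structure IsDefiningFunction {n : ℕ} (Ω : Set (Space n)) (x : Space n) (U : Set (Space n))
    (ρ : Space n → ℝ) : Prop where
  isOpen : IsOpen U
  mem : x ∈ U
  smooth : ContDiffOn ℝ ((⊤ : ℕ∞) : WithTop ℕ∞) ρ U
  gradient_ne_zero : ∀ y ∈ U, gradient ρ y ≠ 0
  mem_iff : ∀ y ∈ U, y ∈ Ω ↔ ρ y < 0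

/-- A bounded domain of `ℝⁿ` with `C^∞` boundary. -/
structure IsSmoothBoundedDomain {n : ℕ} (Ω : Set (Space n)) : Prop where
  isOpen : IsOpen Ω
  isConnected : IsConnected Ω
  isBounded : Bornology.IsBounded Ω
  smooth_boundary : ∀ x ∈ frontier Ω, ∃ U ρ, IsDefiningFunction Ω x U ρ

/-- `ν` is the unit outer normal to `∂Ω` at `x`. -/
def IsOuterNormal {n : ℕ} (Ω : Set (Space n)) (x ν : Space n) : Prop :=
  ‖ν‖ = 1 ∧ ∃ U ρ, IsDefiningFunction Ω x U ρ ∧ gradient ρ x = ‖gradient ρ x‖ • ν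

/-- `Γ₋ = {(x, v) : x ∈ ∂Ω, n(x) · v < 0}`. -/
def incoming {n : ℕ} (Ω : Set (Space n)) : Set (Space n × Space n) :=
  {p | p.1 ∈ frontier Ω ∧ ∃ ν, IsOuterNormal Ω p.1 ν ∧ inner ℝ ν p.2 < 0}

/-- `Γ₊ = {(x, v) : x ∈ ∂Ω, n(x) · v > 0}`. -/
def outgoing {n : ℕ} (Ω : Set (Space n)) : Set (Space n × Space n) :=
  {p | p.1 ∈ frontier Ω ∧ ∃ ν, IsOuterNormal Ω p.1 ν ∧ 0 < inner ℝ ν p.2}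

/-- The points `(x, v)` of `Γ₊` at which the trajectory arriving with velocity `v` has entered `Ω`
through `Γ₋`. For convex `Ω` this is all of `Γ₊`. For non-convex `Ω` a null set of trajectories
enters `Ω` tangentially, at a boundary point outside `Γ₋`; no incoming datum is prescribed
there, and the incoming data do not determine the solution on these trajectories. -/
def transversalOutgoing {n : ℕ} (Ω : Set (Space n)) : Set (Space n × Space n) :=
  {p | p ∈ outgoing Ω ∧ ∃ t : ℝ, 0 < t ∧ (p.1 - t • p.2, p.2) ∈ incoming Ω ∧
    ∀ s ∈ Ioo 0 t, p.1 - s • p.2 ∈ Ω}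

/-- `τ₊(x, v) = sup {s ≥ 0 : x + s v ∈ Ω}`. -/
noncomputable def tauPlus {n : ℕ} (Ω : Set (Space n)) (x v : Space n) : ℝ≥0∞ :=
  ⨆ (s : ℝ) (_ : 0 ≤ s ∧ x + s • v ∈ Ω), ENNReal.ofReal s

/-- `τ₋(x, v) = sup {s ≥ 0 : x - s v ∈ Ω}`. -/
noncomputable def tauMinus {n : ℕ} (Ω : Set (Space n)) (x v : Space n) : ℝ≥0∞ :=
  ⨆ (s : ℝ) (_ : 0 ≤ s ∧ x - s • v ∈ Ω), ENNReal.ofReal s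

/-! ### Assumptions on the collision kernel -/

/-- `∫_{ℝⁿ} ∫_{𝕊ⁿ⁻¹} |B(v, u, ω)| dω du`. -/
noncomputable def kernelMass {n : ℕ} (B : Kernel n) (v : Space n) : ℝ≥0∞ :=
  ∫⁻ u : Space n, ∫⁻ ω : USphere n, ‖B v u ω‖ₑ ∂(sphereMeasure n)

/-- `B ∈ C(ℝⁿ × ℝⁿ × 𝕊ⁿ⁻¹)`. -/
def IsContinuousKernel {n : ℕ} (B : Kernel n) : Prop :=
  Continuous fun p : Space n × Space n × USphere n => B p.1 p.2.1 p.2.2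

/-- There is a finite `M > 0` with `τ_±(x, v) ∫∫ |B(v, u, ω)| dω du < M` for all `x` in the closure
of `Ω` and all `v ≠ 0`. -/
def KernelBound {n : ℕ} (Ω : Set (Space n)) (B : Kernel n) : Prop :=
  ∃ M : ℝ, 0 < M ∧ ∀ x ∈ closure Ω, ∀ v : Space n, v ≠ 0 →
    tauPlus Ω x v * kernelMass B v < ENNReal.ofReal M ∧
    tauMinus Ω x v * kernelMass B v < ENNReal.ofReal M

/-- `B(v, u, ω) = B(u, v, ω)` and `B(v, u, -ω) = B(v, u, ω)`. -/
def KernelSymmetric {n : ℕ} (B : Kernel n) : Prop :=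
  (∀ v u ω, B v u ω = B u v ω) ∧ (∀ v u ω, B v u (-ω) = B v u ω)

/-! ### The Boltzmann equation -/

/-- `u' = u - [(u - v) · ω] ω`. -/
noncomputable def uPrime {n : ℕ} (v u : Space n) (ω : USphere n) : Space n :=
  u - (inner ℝ (u - v) (ω : Space n)) • (ω : Space n)

/-- `v' = v + [(u - v) · ω] ω`. -/
noncomputable def vPrime {n : ℕ} (v u : Space n) (ω : USphere n) : Space n :=
  v + (inner ℝ (u - v) (ω : Space n)) • (ω : Space n)

/-- The collision operator
`Q(H₁, H₂)(x, v) = ∫∫ B(v, u, ω) [H₁(x, u') H₂(x, v') - H₁(x, u) H₂(x, v)] dω du`. -/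
noncomputable def collision {n : ℕ} (B : Kernel n) (H₁ H₂ : Space n → Space n → ℝ)
    (x v : Space n) : ℝ :=
  ∫ u : Space n, ∫ ω : USphere n,
    B v u ω * (H₁ x (uPrime v u ω) * H₂ x (vPrime v u ω) - H₁ x u * H₂ x v) ∂(sphereMeasure n)

/-- `F` is a solution of `v · ∇ₓ F = Q(F, F)` in `Ω × ℝⁿ`, `F = g` on `Γ₋`, with `|F| ≤ δ`.

The transport equation is integrated along the characteristics `s ↦ (x + s v, v)` inside `Ω`, and
the boundary value is attained along them. Under `KernelBound` a continuous kernel has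
`B(0, ·, ·) = 0`, so there is no condition at `v = 0`. -/
structure IsSmallSolution {n : ℕ} (Ω : Set (Space n)) (B : Kernel n) (δ : ℝ)
    (g : Space n × Space n → ℝ) (F : Space n → Space n → ℝ) : Prop where
  measurable : Measurable (Function.uncurry F)
  bound : ∀ x ∈ Ω, ∀ v, |F x v| ≤ δ
  transport : ∀ x ∈ Ω, ∀ v : Space n, v ≠ 0 → ∀ t : ℝ, 0 ≤ t →
    (∀ s ∈ Icc 0 t, x + s • v ∈ Ω) →
      F (x + t • v) v - F x v = ∫ s in (0 : ℝ)..t, collision B F F (x + s • v) v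
  inflow : ∀ p ∈ incoming Ω, Tendsto (fun t : ℝ => F (p.1 + t • p.2) p.2) (𝓝[>] 0) (𝓝 (g p))

/-- `h` is the outgoing measurement on `Γ₊` for the incoming datum `g`, that is, the trace
`h(x, v) = lim_{t ↓ 0} F(x - t v, v)` of a solution `F` with `|F| ≤ δ` and `F = g` on `Γ₋`. This is
the graph of the boundary operator `𝒜 : F|_{Γ₋} ↦ F|_{Γ₊}`. -/
def IsMeasurement {n : ℕ} (Ω : Set (Space n)) (B : Kernel n) (δ : ℝ)
    (g h : Space n × Space n → ℝ) : Prop :=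
  ∃ F, IsSmallSolution Ω B δ g F ∧
    ∀ p ∈ outgoing Ω, Tendsto (fun t : ℝ => F (p.1 - t • p.2) p.2) (𝓝[>] 0) (𝓝 (h p))

/-- `𝒜₁(g) = 𝒜₂(g)` for all `g ∈ C(Γ₋)` with `‖g‖ ≤ ε`, for some `ε > 0`; the operators `𝒜ⱼ` are
given by the solutions in a ball of some radius `δ > 0`. -/
def SameMeasurements {n : ℕ} (Ω : Set (Space n)) (B₁ B₂ : Kernel n) : Prop :=
  ∃ ε : ℝ, 0 < ε ∧ ∃ δ : ℝ, 0 < δ ∧ ∀ g : Space n × Space n → ℝ,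
    ContinuousOn g (incoming Ω) → (∀ p ∈ incoming Ω, |g p| ≤ ε) →
      ∀ h₁ h₂, IsMeasurement Ω B₁ δ g h₁ → IsMeasurement Ω B₂ δ g h₂ →
        EqOn h₁ h₂ (transversalOutgoing Ω)

/-- `B(v, u, ω)` does not depend on `ω`. -/
def IndependentOfAngle {n : ℕ} (B : Kernel n) : Prop :=
  ∀ v u ω ω', B v u ω = B v u ω'

end Boltzmann

/-! Prescribe an incoming datum `l φ(v)` that depends on the velocity only. For small `l` the
integrated equation is a contraction, and expanding its solution to second order in `l` shows that
the outgoing trace is `l φ(v) + l² T(x, v) Q(φ, φ)(v) + O(l³)`, where `T` is the time spent in `Ω`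
since the entrance. For every `v ≠ 0` some trajectory crosses `Ω` transversally with velocity `v`,
and there `T > 0`, so the measurements determine `Q(φ, φ)(v)` for each bounded continuous `φ`. Now
let `φ` be `ψ` plus a spike concentrating at `v`. For `n ≥ 2` the velocities `u`, `u'`, `v'` avoid
`v` for almost every `(u, ω)`, so the spike survives only in the factor `φ(v)` of the loss term,
and the measurements determine `∫∫ B(v, u, ω) ψ(u) dω du` for all `ψ`. Hence they determine
`∫ B(v, u, ω) dω`, and two continuous functions of `ω` that are ordered and have the same integral
are equal. -/

namespace Boltzmann

variable {n : ℕ} {Ω : Set (Space n)} {x y z v : Space n}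

/-! ### Trajectories that cross the domain transversally -/

lemma eventually_pos_of_hasDerivAt {f : ℝ → ℝ} {f' a : ℝ} (hf : HasDerivAt f f' a)
    (ha : f a = 0) (hf' : 0 < f') : ∀ᶠ t in 𝓝[>] a, 0 < f t := by
  have hsign := eventually_nhdsWithin_sign_eq_of_deriv_pos (hf.deriv.symm ▸ hf') ha
  filter_upwards [nhdsWithin_le_nhds hsign, self_mem_nhdsWithin] with t ht hat
  rwa [sign_pos (sub_pos.2 hat), sign_eq_one_iff] at ht

lemma eventually_add_smul_mem {U : Set (Space n)} (hU : U ∈ 𝓝 y) (v : Space n) :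
    ∀ᶠ t : ℝ in 𝓝[>] 0, y + t • v ∈ U := by
  have hline : ContinuousAt (fun t : ℝ => y + t • v) 0 := by fun_prop
  exact nhdsWithin_le_nhds (hline.eventually_mem (by simpa using hU))

namespace IsDefiningFunction

variable {U : Set (Space n)} {ρ : Space n → ℝ}

lemma hasGradientAt (h : IsDefiningFunction Ω x U ρ) (hy : y ∈ U) :
    HasGradientAt ρ (gradient ρ y) y :=
  ((h.smooth.contDiffAt (h.isOpen.mem_nhds hy)).differentiableAt (by simp)).hasGradientAt

lemma hasDerivAt_line (h : IsDefiningFunction Ω x U ρ) (hy : y ∈ U) (v : Space n) :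
    HasDerivAt (fun t : ℝ => ρ (y + t • v)) (inner ℝ (gradient ρ y) v) 0 :=
  (h.hasGradientAt hy).hasFDerivAt.hasLineDerivAt v

lemma isOpen_inner_gradient_pos (h : IsDefiningFunction Ω x U ρ) (v : Space n) :
    IsOpen {y ∈ U | 0 < inner ℝ (gradient ρ y) v} := by
  have hgrad : ContinuousOn (gradient ρ) U :=
    (InnerProductSpace.toDual ℝ (Space n)).symm.continuous.comp_continuousOn
      (h.smooth.continuousOn_fderiv_of_isOpen h.isOpen (by simp))
  exact (hgrad.inner continuousOn_const).isOpen_inter_preimage h.isOpen isOpen_Ioi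

lemma isOpen_pos (h : IsDefiningFunction Ω x U ρ) : IsOpen {y ∈ U | 0 < ρ y} :=
  h.smooth.continuousOn.isOpen_inter_preimage h.isOpen isOpen_Ioi

lemma notMem_of_pos (h : IsDefiningFunction Ω x U ρ) (hy : y ∈ U) (hpos : 0 < ρ y) : y ∉ Ω :=
  fun hyΩ => hpos.not_gt ((h.mem_iff y hy).1 hyΩ)

lemma eq_zero (h : IsDefiningFunction Ω x U ρ) (hΩ : IsOpen Ω) (hx : x ∈ frontier Ω) :
    ρ x = 0 := by
  rw [hΩ.frontier_eq] at hx
  refine le_antisymm (not_lt.1 fun hpos => ?_)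
    (not_lt.1 fun hneg => hx.2 ((h.mem_iff x h.mem).2 hneg))
  obtain ⟨y, ⟨hyU, hy⟩, hyΩ⟩ :=
    mem_closure_iff_nhds.1 hx.1 _ (h.isOpen_pos.mem_nhds ⟨h.mem, hpos⟩)
  exact h.notMem_of_pos hyU hy hyΩ

lemma eventually_pos (h : IsDefiningFunction Ω x U ρ) (hΩ : IsOpen Ω) (hx : x ∈ frontier Ω)
    (hv : 0 < inner ℝ (gradient ρ x) v) :
    ∀ᶠ t : ℝ in 𝓝[>] 0, x + t • v ∈ {y ∈ U | 0 < ρ y} :=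
  (eventually_add_smul_mem (h.isOpen.mem_nhds h.mem) v).and
    (eventually_pos_of_hasDerivAt (h.hasDerivAt_line h.mem v) (by simpa using h.eq_zero hΩ hx) hv)

lemma eventually_mem (h : IsDefiningFunction Ω x U ρ) (hΩ : IsOpen Ω) (hx : x ∈ frontier Ω)
    (hv : inner ℝ (gradient ρ x) v < 0) : ∀ᶠ t : ℝ in 𝓝[>] 0, x + t • v ∈ Ω := by
  have hneg := eventually_pos_of_hasDerivAt (h.hasDerivAt_line h.mem v).neg
    (by simpa using h.eq_zero hΩ hx) (neg_pos.2 hv)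
  filter_upwards [eventually_add_smul_mem (h.isOpen.mem_nhds h.mem) v, hneg] with t htU ht
  exact (h.mem_iff _ htU).2 (neg_pos.1 ht)

lemma congr_point (h : IsDefiningFunction Ω x U ρ) (hy : y ∈ U) : IsDefiningFunction Ω y U ρ :=
  ⟨h.isOpen, hy, h.smooth, h.gradient_ne_zero, h.mem_iff⟩

lemma mem_outgoing (h : IsDefiningFunction Ω x U ρ) (hx : x ∈ frontier Ω)
    (hv : 0 < inner ℝ (gradient ρ x) v) : (x, v) ∈ outgoing Ω := by
  have hpos : 0 < ‖gradient ρ x‖ := norm_pos_iff.2 (h.gradient_ne_zero x h.mem)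
  refine ⟨hx, ‖gradient ρ x‖⁻¹ • gradient ρ x, ⟨?_, U, ρ, h, ?_⟩, ?_⟩
  · exact norm_smul_inv_norm (h.gradient_ne_zero x h.mem)
  · rw [smul_inv_smul₀ hpos.ne']
  · rw [real_inner_smul_left]
    positivity

end IsDefiningFunction

lemma exists_definingFunction_of_mem_outgoing (h : (x, v) ∈ outgoing Ω) :
    x ∈ frontier Ω ∧ ∃ U ρ, IsDefiningFunction Ω x U ρ ∧ 0 < inner ℝ (gradient ρ x) v := by
  obtain ⟨hx, ν, ⟨-, U, ρ, hρ, hν⟩, hv⟩ := h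
  refine ⟨hx, U, ρ, hρ, ?_⟩
  rw [hν, real_inner_smul_left]
  exact mul_pos (norm_pos_iff.2 (hρ.gradient_ne_zero _ hρ.mem)) hv

lemma mem_incoming_iff_neg_mem_outgoing : (x, v) ∈ incoming Ω ↔ (x, -v) ∈ outgoing Ω := by
  simp [incoming, outgoing]

lemma velocity_ne_zero_of_mem_outgoing (h : (x, v) ∈ outgoing Ω) : v ≠ 0 := by
  obtain ⟨-, ν, -, hv⟩ := h
  rintro rfl
  simp at hv

lemma eventually_sub_mem_of_mem_outgoing (hΩ : IsOpen Ω) (h : (x, v) ∈ outgoing Ω) :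
    ∀ᶠ t : ℝ in 𝓝[>] 0, x - t • v ∈ Ω := by
  obtain ⟨hx, U, ρ, hρ, hv⟩ := exists_definingFunction_of_mem_outgoing h
  simpa [sub_eq_add_neg] using hρ.eventually_mem (v := -v) hΩ hx (by simpa using hv)

lemma mem_outgoing_of_isLocalMinOn_compl (hΩ : IsSmoothBoundedDomain Ω) (hx : x ∈ frontier Ω)
    {f : Space n → ℝ} {f' : Space n →L[ℝ] ℝ} (hf : HasFDerivAt f f' x)
    (hmin : IsLocalMinOn f Ωᶜ x) (hv : 0 < f' v) : (x, v) ∈ outgoing Ω := by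
  obtain ⟨U, ρ, hρ⟩ := hΩ.smooth_boundary x hx
  refine hρ.mem_outgoing hx ?_
  have hnonneg : ∀ k, 0 < inner ℝ (gradient ρ x) k → 0 ≤ f' k := fun k hk =>
    hmin.hasFDerivWithinAt_nonneg hf.hasFDerivWithinAt <|
      mem_posTangentConeAt_of_frequently_mem <| Eventually.frequently <|
        (hρ.eventually_pos hΩ.isOpen hx hk).mono fun _ ht => hρ.notMem_of_pos ht.1 ht.2
  by_contra! hle
  have hlim : ContinuousAt (fun t : ℝ => -f' v + t * f' (gradient ρ x)) 0 := by fun_prop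
  have hsmall : ∀ᶠ t : ℝ in 𝓝[>] 0, -f' v + t * f' (gradient ρ x) < 0 :=
    nhdsWithin_le_nhds (hlim.eventually_lt_const (by simpa using hv))
  obtain ⟨t, ht, htpos⟩ := (hsmall.and self_mem_nhdsWithin).exists
  refine ht.not_ge ?_
  have hsq := real_inner_self_pos.2 (hρ.gradient_ne_zero x hρ.mem)
  simpa using hnonneg (-v + t • gradient ρ x) (by
    rw [inner_add_right, inner_neg_right, real_inner_smul_right]
    linarith [mul_pos (mem_Ioi.1 htpos) hsq])

/-- The trajectory that starts at `z` with velocity `v` stays in `Ω` until it leaves through `Γ₊` at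
the time `τ > 0`. -/
structure LeavesAt (Ω : Set (Space n)) (z v : Space n) (τ : ℝ) : Prop where
  pos : 0 < τ
  mem_outgoing : (z + τ • v, v) ∈ outgoing Ω
  mem : ∀ s ∈ Ico 0 τ, z + s • v ∈ Ω

lemma mem_frontier_of_forall_mem (hΩ : IsOpen Ω) {τ : ℝ} (hτ : 0 < τ)
    (hmem : ∀ s ∈ Ico 0 τ, z + s • v ∈ Ω) (hout : z + τ • v ∉ Ω) : z + τ • v ∈ frontier Ω := by
  rw [hΩ.frontier_eq]
  refine ⟨?_, hout⟩
  have hline : Continuous fun s : ℝ => z + s • v := by fun_prop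
  have hτ' : τ ∈ closure (Ico 0 τ) := by simpa [closure_Ico hτ.ne] using hτ.le
  exact closure_mono (image_subset_iff.2 hmem) (mem_closure_image hline.continuousAt hτ')

lemma exists_forall_add_smul_notMem (hΩ : Bornology.IsBounded Ω) (y : Space n) (hv : v ≠ 0) :
    ∃ D : ℝ, 0 < D ∧ ∀ s : ℝ, D ≤ |s| → y + s • v ∉ Ω := by
  obtain ⟨R, hR, hΩR⟩ := hΩ.subset_ball_lt 0 y
  have hnorm := norm_pos_iff.2 hv
  refine ⟨R / ‖v‖, by positivity, fun s hs hmem => (mem_ball_iff_norm.1 (hΩR hmem)).not_ge ?_⟩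
  rwa [add_sub_cancel_left, norm_smul, Real.norm_eq_abs, ← div_le_iff₀ hnorm]

/-- A quadratic function that grows at the unit rate `‖v‖²` along `v` and whose sublevel sets in
`{q | 0 ≤ ⟪v, q - y⟫}` are caps of paraboloids, narrow around the ray from `y` along `v` for
large `C`. -/
noncomputable def paraboloid (C : ℝ) (y v q : Space n) : ℝ :=
  inner ℝ v (q - y) + C * (‖v‖ ^ 2 * ‖q - y‖ ^ 2 - inner ℝ v (q - y) ^ 2)

lemma paraboloid_add_smul (C : ℝ) (y v q : Space n) (s : ℝ) :
    paraboloid C y v (q + s • v) = paraboloid C y v q + s * ‖v‖ ^ 2 := by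
  simp only [paraboloid, add_sub_right_comm q, norm_add_sq_real, inner_add_right,
    real_inner_smul_right, real_inner_self_eq_norm_sq, norm_smul, mul_pow, Real.norm_eq_abs,
    sq_abs, real_inner_comm v]
  ring

lemma continuous_paraboloid (C : ℝ) (y v : Space n) : Continuous (paraboloid C y v) := by
  unfold paraboloid
  fun_prop

lemma differentiable_paraboloid (C : ℝ) (y v : Space n) : Differentiable ℝ (paraboloid C y v) := by
  have hinner : Differentiable ℝ fun q => inner ℝ v (q - y) :=
    (differentiable_const v).inner ℝ (differentiable_id.sub_const y)
  have hnorm : Differentiable ℝ fun q => ‖q - y‖ ^ 2 := (differentiable_id.sub_const y).norm_sq ℝ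
  unfold paraboloid
  fun_prop

lemma fderiv_paraboloid_apply (C : ℝ) (y v q : Space n) :
    fderiv ℝ (paraboloid C y v) q v = ‖v‖ ^ 2 := by
  rw [← (differentiable_paraboloid C y v q).lineDeriv_eq_fderiv, lineDeriv]
  simp [paraboloid_add_smul]

lemma exists_eq_add_smul_of_paraboloid_le {C D r : ℝ} (hr : 0 < r) (hC : 0 < C)
    (hCD : D < C * r ^ 2) (hv : v ≠ 0) (hx : 0 ≤ inner ℝ v (x - y))
    (hle : paraboloid C y v x ≤ D * ‖v‖ ^ 2) :
    ∃ z ∈ Metric.ball y r, inner ℝ v (z - y) = 0 ∧ ∃ s ∈ Icc 0 D, x = z + s • v := by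
  have hsq : 0 < ‖v‖ ^ 2 := by have := norm_pos_iff.2 hv; positivity
  set s := inner ℝ v (x - y) / ‖v‖ ^ 2 with hs
  have hs0 : 0 ≤ s := by positivity
  have horth : inner ℝ v (x - s • v - y) = 0 := by
    rw [sub_right_comm, inner_sub_right, real_inner_smul_right, real_inner_self_eq_norm_sq, hs,
      div_mul_cancel₀ _ hsq.ne', sub_self]
  have hsplit := paraboloid_add_smul C y v (x - s • v) s
  rw [sub_add_cancel] at hsplit
  have hslice : paraboloid C y v (x - s • v) = C * ‖x - s • v - y‖ ^ 2 * ‖v‖ ^ 2 := by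
    rw [paraboloid, horth]
    ring
  have hsum : C * ‖x - s • v - y‖ ^ 2 + s ≤ D :=
    le_of_mul_le_mul_right (by linarith [hsplit, hslice]) hsq
  refine ⟨x - s • v, ?_, horth, s, ⟨hs0, ?_⟩, (sub_add_cancel _ _).symm⟩
  · rw [mem_ball_iff_norm]
    exact lt_of_pow_lt_pow_left₀ 2 hr.le (lt_of_mul_lt_mul_left (by linarith) hC.le)
  · have : 0 ≤ C * ‖x - s • v - y‖ ^ 2 := by positivity
    linarith

lemma exists_isMinOn_paraboloid {S : Set (Space n)} (hS : IsClosed S)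
    (hSv : ∀ q ∈ S, 0 ≤ inner ℝ v (q - y)) (hv : v ≠ 0) {D r : ℝ} (hD : 0 < D)
    (hDS : y + D • v ∈ S) (hr : 0 < r) :
    ∃ C : ℝ, ∃ z ∈ Metric.ball y r, inner ℝ v (z - y) = 0 ∧
      ∃ τ : ℝ, 0 ≤ τ ∧ z + τ • v ∈ S ∧ IsMinOn (paraboloid C y v) S (z + τ • v) := by
  obtain ⟨C, hC, hCD⟩ : ∃ C : ℝ, 0 < C ∧ D < C * r ^ 2 :=
    ⟨(D + 1) / r ^ 2, by positivity, by rw [div_mul_cancel₀ _ (by positivity)]; linarith⟩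
  have hval : paraboloid C y v (y + D • v) = D * ‖v‖ ^ 2 := by
    rw [paraboloid_add_smul]
    simp [paraboloid]
  have hcoercive : ∀ᶠ q in cocompact (Space n) ⊓ 𝓟 S,
      paraboloid C y v (y + D • v) ≤ paraboloid C y v q := by
    have hK : IsCompact ((fun p : Space n × ℝ => p.1 + p.2 • v) ''
        (Metric.closedBall y r ×ˢ Icc 0 D)) :=
      ((isCompact_closedBall y r).prod isCompact_Icc).image (by fun_prop)
    refine eventually_inf_principal.2 (mem_of_superset hK.compl_mem_cocompact fun q hqK hqS => ?_)
    by_contra! hlt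
    obtain ⟨z, hz, -, s, hs, rfl⟩ :=
      exists_eq_add_smul_of_paraboloid_le hr hC hCD hv (hSv q hqS) (hlt.le.trans_eq hval)
    exact hqK ⟨(z, s), ⟨Metric.ball_subset_closedBall hz, hs⟩, rfl⟩
  obtain ⟨q, hqS, hmin⟩ :=
    (continuous_paraboloid C y v).continuousOn.exists_isMinOn' hS hDS hcoercive
  obtain ⟨z, hz, horth, τ, hτ, rfl⟩ := exists_eq_add_smul_of_paraboloid_le hr hC hCD hv
    (hSv q hqS) ((hmin hDS).trans_eq hval)
  exact ⟨C, z, hz, horth, τ, hτ.1, hqS, hmin⟩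

/-- The point is found by sliding a narrow paraboloid along `v` until it touches the complement
of `Ω`; at the point of contact the axis of the paraboloid is transversal to the boundary. -/
lemma exists_leavesAt_mem_ball (hΩ : IsSmoothBoundedDomain Ω) (hv : v ≠ 0) {r : ℝ} (hr : 0 < r)
    (hball : Metric.ball y r ⊆ Ω) : ∃ z ∈ Metric.ball y r, ∃ τ, LeavesAt Ω z v τ := by
  have hsq : 0 < ‖v‖ ^ 2 := by have := norm_pos_iff.2 hv; positivity
  set S : Set (Space n) := {q | q ∉ Ω ∧ 0 ≤ inner ℝ v (q - y)}
  have hhalfspace : IsClosed {q : Space n | 0 ≤ inner ℝ v (q - y)} :=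
    isClosed_le (by fun_prop) (by fun_prop)
  have hSclosed : IsClosed S := hΩ.isOpen.isClosed_compl.inter hhalfspace
  obtain ⟨D, hD, hout⟩ := exists_forall_add_smul_notMem hΩ.isBounded y hv
  have hDS : y + D • v ∈ S := ⟨hout D (le_abs_self D), by
    rw [add_sub_cancel_left, real_inner_smul_right, real_inner_self_eq_norm_sq]
    positivity⟩
  obtain ⟨C, z, hz, horth, τ, hτ, hτS, hmin⟩ :=
    exists_isMinOn_paraboloid hSclosed (fun _ hq => hq.2) hv hD hDS hr
  have hinner (s : ℝ) : inner ℝ v (z + s • v - y) = s * ‖v‖ ^ 2 := by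
    rw [add_sub_right_comm, inner_add_right, horth, real_inner_smul_right,
      real_inner_self_eq_norm_sq, zero_add]
  have hτpos : 0 < τ := hτ.lt_of_ne fun h => hτS.1 (by simpa [← h] using hball hz)
  have hmem : ∀ s ∈ Ico 0 τ, z + s • v ∈ Ω := fun s hs => by
    by_contra hsΩ
    have hle := isMinOn_iff.1 hmin (z + s • v)
      ⟨hsΩ, (hinner s).symm ▸ mul_nonneg hs.1 hsq.le⟩
    simp only [paraboloid_add_smul] at hle
    nlinarith [hs.2]
  have hlocal : IsLocalMinOn (paraboloid C y v) Ωᶜ (z + τ • v) := by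
    have hhalf : ∀ᶠ q in 𝓝 (z + τ • v), 0 < inner ℝ v (q - y) :=
      (isOpen_lt (by fun_prop) (by fun_prop)).mem_nhds
        (show 0 < inner ℝ v (z + τ • v - y) by rw [hinner]; positivity)
    filter_upwards [nhdsWithin_le_nhds hhalf, self_mem_nhdsWithin] with q hq hqΩ
    exact hmin ⟨hqΩ, hq.le⟩
  exact ⟨z, hz, τ, hτpos, mem_outgoing_of_isLocalMinOn_compl hΩ
    (mem_frontier_of_forall_mem hΩ.isOpen hτpos hmem hτS.1)
    (differentiable_paraboloid C y v _).hasFDerivAt hlocal (by rwa [fderiv_paraboloid_apply]),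
    hmem⟩

lemma eventually_forall_add_smul_mem {U : Set (Space n)} (hU : IsOpen U) {K : Set ℝ}
    (hK : IsCompact K) (h : ∀ s ∈ K, z + s • v ∈ U) : ∀ᶠ w in 𝓝 z, ∀ s ∈ K, w + s • v ∈ U := by
  refine hK.eventually_forall_of_forall_eventually fun s hs => ?_
  have hline : ContinuousAt (fun q : Space n × ℝ => q.1 + q.2 • v) (z, s) := by fun_prop
  exact hline.eventually_mem (hU.mem_nhds (h s hs))

lemma exists_first_exit (hΩ : IsOpen Ω) {D : ℝ} (hz : z ∈ Ω) (hD : 0 ≤ D)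
    (hout : z + D • v ∉ Ω) :
    ∃ τ ∈ Ioc 0 D, z + τ • v ∉ Ω ∧ ∀ s ∈ Ico 0 τ, z + s • v ∈ Ω := by
  have hclosed : IsClosed {s : ℝ | z + s • v ∉ Ω} := hΩ.isClosed_compl.preimage (by fun_prop)
  obtain ⟨τ, ⟨hτD, hτ⟩, hmin⟩ :=
    (isCompact_Icc.inter_right hclosed).exists_isLeast ⟨D, ⟨hD, le_rfl⟩, hout⟩
  refine ⟨τ, ⟨hτD.1.lt_of_ne fun h => hτ (by simpa [← h] using hz), hτD.2⟩, hτ, fun s hs => ?_⟩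
  by_contra hs'
  exact hs.2.not_ge (hmin ⟨⟨hs.1, hs.2.le.trans hτD.2⟩, hs'⟩)

lemma LeavesAt.eventually (hΩ : IsOpen Ω) {τ : ℝ} (h : LeavesAt Ω z v τ) :
    ∀ᶠ w in 𝓝 z, ∃ σ, LeavesAt Ω w v σ := by
  obtain ⟨hfr, U, ρ, hρ, hv⟩ := exists_definingFunction_of_mem_outgoing h.mem_outgoing
  set N : Set (Space n) := {y ∈ U | 0 < inner ℝ (gradient ρ y) v}
  have hNopen : IsOpen N := hρ.isOpen_inner_gradient_pos v
  obtain ⟨η, hη, hηN⟩ : ∃ η > 0, ∀ s ∈ Icc (τ - η) (τ + η), z + s • v ∈ N := by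
    have hline : ContinuousAt (fun s : ℝ => z + s • v) τ := by fun_prop
    obtain ⟨η, hη, hsub⟩ := Metric.nhds_basis_closedBall.mem_iff.1
      (hline.preimage_mem_nhds (hNopen.mem_nhds ⟨hρ.mem, hv⟩))
    exact ⟨η, hη, fun s hs => hsub (Real.closedBall_eq_Icc ▸ hs)⟩
  obtain ⟨t, hpast, ht⟩ := ((hρ.eventually_pos hΩ hfr hv).and
    (Ioo_mem_nhdsGT (lt_min h.pos hη))).exists
  obtain ⟨htτ, htη⟩ := lt_min_iff.1 ht.2
  have hinside := eventually_forall_add_smul_mem hΩ (isCompact_Icc (a := 0) (b := τ - t))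
    fun s hs => h.mem s ⟨hs.1, by linarith [hs.2, ht.1]⟩
  have hnear := eventually_forall_add_smul_mem hNopen (isCompact_Icc (a := τ - t) (b := τ + t))
    fun s hs => hηN s ⟨by linarith [hs.1], by linarith [hs.2]⟩
  have hbeyond := eventually_forall_add_smul_mem hρ.isOpen_pos (isCompact_singleton (x := τ + t))
    fun s hs => by rwa [mem_singleton_iff.1 hs, add_smul, ← add_assoc]
  filter_upwards [hinside, hnear, hbeyond] with w hwin hwnear hwout
  obtain ⟨hoU, hopos⟩ := hwout (τ + t) rfl
  obtain ⟨σ, hσ, hσout, hσmem⟩ := exists_first_exit hΩ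
    (by simpa using hwin 0 ⟨le_rfl, by linarith⟩) (by linarith [ht.1]) (hρ.notMem_of_pos hoU hopos)
  have hσt : τ - t ≤ σ := not_lt.1 fun hlt => hσout (hwin σ ⟨hσ.1.le, hlt.le⟩)
  obtain ⟨hσU, hσv⟩ := hwnear σ ⟨hσt, hσ.2⟩
  exact ⟨σ, hσ.1, (hρ.congr_point hσU).mem_outgoing
    (mem_frontier_of_forall_mem hΩ hσ.1 hσmem hσout) hσv, hσmem⟩

theorem exists_mem_transversalOutgoing (hΩ : IsSmoothBoundedDomain Ω) (hv : v ≠ 0) :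
    ∃ x, (x, v) ∈ transversalOutgoing Ω := by
  obtain ⟨y, hy⟩ := hΩ.isConnected.nonempty
  obtain ⟨r, hr, hball⟩ := Metric.isOpen_iff.1 hΩ.isOpen y hy
  obtain ⟨z, hz, τ, hτ⟩ := exists_leavesAt_mem_ball hΩ hv hr hball
  obtain ⟨r', hr', hball'⟩ := Metric.mem_nhds_iff.1
    ((hτ.eventually hΩ.isOpen).and (hΩ.isOpen.mem_nhds (hball hz)))
  obtain ⟨w, hw, σ, hσ⟩ :=
    exists_leavesAt_mem_ball hΩ (neg_ne_zero.2 hv) hr' fun q hq => (hball' hq).2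
  obtain ⟨κ, hκ⟩ := (hball' hw).1
  refine ⟨w + κ • v, hκ.mem_outgoing, κ + σ, add_pos hκ.pos hσ.pos, ?_, fun s hs => ?_⟩
  · rw [mem_incoming_iff_neg_mem_outgoing]
    convert hσ.mem_outgoing using 2
    module
  · rcases le_total s κ with h | h
    · convert hκ.mem (κ - s) ⟨by linarith, by linarith [hs.1]⟩ using 1
      module
    · convert hσ.mem (s - κ) ⟨by linarith, by linarith [hs.2]⟩ using 1
      module

/-! ### The collision operator at a fixed position -/

instance : IsFiniteMeasure (sphereMeasure n) := by unfold sphereMeasure; infer_instance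

instance : (sphereMeasure n).IsOpenPosMeasure := by unfold sphereMeasure; infer_instance

/-- The product `du dω` of Lebesgue measure and the surface measure. -/
noncomputable abbrev collisionMeasure (n : ℕ) : Measure (Space n × USphere n) :=
  (volume : Measure (Space n)).prod (sphereMeasure n)

/-- The difference `H(u') H(v') - H(u) H(v)` for the collision `q = (u, ω)`. -/
noncomputable def collisionBracket (H : Space n → ℝ) (v : Space n) (q : Space n × USphere n) : ℝ :=
  H (uPrime v q.1 q.2) * H (vPrime v q.1 q.2) - H q.1 * H v

/-- The collision operator at a fixed position, acting on the velocity distribution `H` there, as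
one integral over `du dω`. -/
noncomputable def velocityCollision (B : Kernel n) (H : Space n → ℝ) (v : Space n) : ℝ :=
  ∫ q, B v q.1 q.2 * collisionBracket H v q ∂(collisionMeasure n)

lemma continuous_uPrime :
    Continuous fun p : Space n × Space n × USphere n => uPrime p.1 p.2.1 p.2.2 := by
  unfold uPrime; fun_prop

lemma continuous_vPrime :
    Continuous fun p : Space n × Space n × USphere n => vPrime p.1 p.2.1 p.2.2 := by
  unfold vPrime; fun_prop

lemma IsContinuousKernel.continuous_fixed {B : Kernel n} (hB : IsContinuousKernel B)
    (v : Space n) : Continuous fun q : Space n × USphere n => B v q.1 q.2 :=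
  hB.comp (Continuous.prodMk_right v)

section Estimates

variable {H K : Space n → ℝ} {r d : ℝ}

lemma measurable_collisionBracket_uncurry {F : Space n → Space n → ℝ}
    (hF : Measurable (Function.uncurry F)) :
    Measurable fun a : (Space n × Space n) × Space n × USphere n =>
      collisionBracket (F a.1.1) a.1.2 a.2 := by
  have hcomp {f : (Space n × Space n) × Space n × USphere n → Space n} (hf : Measurable f) :
      Measurable fun a => F a.1.1 (f a) :=
    hF.comp ((measurable_fst.comp measurable_fst).prodMk hf)
  have hu := continuous_uPrime (n := n).measurable.comp
    (by fun_prop : Measurable fun a : (Space n × Space n) × Space n × USphere n => (a.1.2, a.2))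
  have hv := continuous_vPrime (n := n).measurable.comp
    (by fun_prop : Measurable fun a : (Space n × Space n) × Space n × USphere n => (a.1.2, a.2))
  exact ((hcomp hu).mul (hcomp hv)).sub ((hcomp (by fun_prop)).mul (hcomp (by fun_prop)))

lemma measurable_collisionBracket (hH : Measurable H) (v : Space n) :
    Measurable (collisionBracket H v) :=
  (measurable_collisionBracket_uncurry (F := fun _ => H) (hH.comp measurable_snd)).comp
    (by fun_prop : Measurable fun q : Space n × USphere n => (((0 : Space n), v), q))

lemma abs_mul_sub_mul_le {a a' b b' r d : ℝ} (ha : |a| ≤ r) (hb' : |b'| ≤ r) (hab : |a - b| ≤ d)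
    (hab' : |a' - b'| ≤ d) : |a * a' - b * b'| ≤ 2 * r * d :=
  calc |a * a' - b * b'| = |a * (a' - b') + (a - b) * b'| := by ring_nf
    _ ≤ |a| * |a' - b'| + |a - b| * |b'| := by
      simpa only [abs_mul] using abs_add_le (a * (a' - b')) ((a - b) * b')
    _ ≤ r * d + d * r := by
      gcongr
      · exact (abs_nonneg _).trans ha
      · exact (abs_nonneg _).trans hab
    _ = 2 * r * d := by ring

lemma abs_collisionBracket_sub_le (hH : ∀ w, |H w| ≤ r) (hK : ∀ w, |K w| ≤ r)
    (hHK : ∀ w, |H w - K w| ≤ d) (v : Space n) (q : Space n × USphere n) :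
    |collisionBracket H v q - collisionBracket K v q| ≤ 4 * r * d := by
  have hgain := abs_mul_sub_mul_le (hH (uPrime v q.1 q.2)) (hK (vPrime v q.1 q.2)) (hHK _) (hHK _)
  have hloss := abs_mul_sub_mul_le (hH q.1) (hK v) (hHK _) (hHK _)
  rw [collisionBracket, collisionBracket, sub_sub_sub_comm]
  exact (abs_sub _ _).trans (by linarith)

lemma abs_collisionBracket_le (hH : ∀ w, |H w| ≤ r) (v : Space n) (q : Space n × USphere n) :
    |collisionBracket H v q| ≤ 4 * r * r := by
  have hr : 0 ≤ r := (abs_nonneg _).trans (hH 0)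
  simpa [collisionBracket] using
    abs_collisionBracket_sub_le (K := fun _ => 0) hH (by simpa using hr) (by simpa using hH) v q

variable {B : Kernel n}

lemma measurable_velocityCollision (hB : IsContinuousKernel B) {F : Space n → Space n → ℝ}
    (hF : Measurable (Function.uncurry F)) :
    Measurable (Function.uncurry fun x v => velocityCollision B (F x) v) := by
  have hBm : Measurable fun a : (Space n × Space n) × Space n × USphere n =>
      B a.1.2 a.2.1 a.2.2 := hB.measurable.comp
    (by fun_prop : Measurable fun a : (Space n × Space n) × Space n × USphere n => (a.1.2, a.2))
  have h := (hBm.mul (measurable_collisionBracket_uncurry hF)).stronglyMeasurable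
  exact (h.integral_prod_right' (ν := collisionMeasure n)).measurable

lemma integrable_kernel_mul_collisionBracket
    (hB : Integrable (fun q => B v q.1 q.2) (collisionMeasure n)) (hH : Measurable H)
    (hr : ∀ w, |H w| ≤ r) :
    Integrable (fun q => B v q.1 q.2 * collisionBracket H v q) (collisionMeasure n) :=
  hB.mul_bdd (measurable_collisionBracket hH v).aestronglyMeasurable
    (Eventually.of_forall fun q => abs_collisionBracket_le hr v q)

lemma collision_eq_velocityCollision
    (hB : Integrable (fun q => B v q.1 q.2) (collisionMeasure n)) {F : Space n → Space n → ℝ}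
    (hF : Measurable (F x)) (hr : ∀ w, |F x w| ≤ r) :
    collision B F F x v = velocityCollision B (F x) v :=
  (integral_prod _ (integrable_kernel_mul_collisionBracket hB hF hr)).symm

lemma abs_velocityCollision_sub_le
    (hB : Integrable (fun q => B v q.1 q.2) (collisionMeasure n)) (hH : Measurable H)
    (hK : Measurable K) (hHr : ∀ w, |H w| ≤ r) (hKr : ∀ w, |K w| ≤ r)
    (hHK : ∀ w, |H w - K w| ≤ d) :
    |velocityCollision B H v - velocityCollision B K v| ≤
      4 * r * d * ∫ q, ‖B v q.1 q.2‖ ∂(collisionMeasure n) := by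
  rw [velocityCollision, velocityCollision,
    ← integral_sub (integrable_kernel_mul_collisionBracket hB hH hHr)
      (integrable_kernel_mul_collisionBracket hB hK hKr), ← integral_const_mul, ← Real.norm_eq_abs]
  refine norm_integral_le_of_norm_le (hB.norm.const_mul _) (Eventually.of_forall fun q => ?_)
  rw [← mul_sub, norm_mul, mul_comm]
  gcongr
  exact abs_collisionBracket_sub_le hHr hKr hHK v q

lemma abs_velocityCollision_le (hB : Integrable (fun q => B v q.1 q.2) (collisionMeasure n))
    (hH : Measurable H) (hHr : ∀ w, |H w| ≤ r) :
    |velocityCollision B H v| ≤ 4 * r * r * ∫ q, ‖B v q.1 q.2‖ ∂(collisionMeasure n) := by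
  have hr : 0 ≤ r := (abs_nonneg _).trans (hHr 0)
  simpa [velocityCollision, collisionBracket] using abs_velocityCollision_sub_le
    (K := fun _ => 0) hB hH measurable_const hHr (by simpa using hr) (by simpa using hHr)

lemma velocityCollision_const_mul (B : Kernel n) (H : Space n → ℝ) (l : ℝ) (v : Space n) :
    velocityCollision B (fun w => l * H w) v = l ^ 2 * velocityCollision B H v := by
  simp only [velocityCollision, collisionBracket, ← integral_const_mul]
  congr 1 with q
  ring

lemma tendsto_velocityCollision (hB : Integrable (fun q => B v q.1 q.2) (collisionMeasure n))
    {H : ℕ → Space n → ℝ} (hH : ∀ k, Measurable (H k)) (hr : ∀ k w, |H k w| ≤ r)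
    (hlim : ∀ w, Tendsto (fun k => H k w) atTop (𝓝 (K w))) :
    Tendsto (fun k => velocityCollision B (H k) v) atTop (𝓝 (velocityCollision B K v)) := by
  refine tendsto_integral_of_dominated_convergence (fun q => ‖B v q.1 q.2‖ * (4 * r * r))
    (fun k => (integrable_kernel_mul_collisionBracket hB (hH k) (hr k)).aestronglyMeasurable)
    (hB.norm.mul_const _) (fun k => Eventually.of_forall fun q => ?_)
    (Eventually.of_forall fun q => ?_)
  · rw [norm_mul]
    gcongr
    exact abs_collisionBracket_le (hr k) v q
  · exact (((hlim _).mul (hlim _)).sub ((hlim _).mul (hlim _))).const_mul _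

end Estimates

lemma ae_sub_notMem_submodule (v : Space n) {W : Submodule ℝ (Space n)} (hW : W ≠ ⊤) :
    ∀ᵐ u : Space n, u - v ∉ W := by
  simpa only [sub_eq_add_neg, SetLike.mem_coe] using (eventually_add_right_iff volume (-v)).2
    (compl_mem_ae_iff.2 (Measure.addHaar_submodule volume W hW))

lemma ae_collision_ne (hn : 2 ≤ n) (v : Space n) :
    ∀ᵐ q ∂(collisionMeasure n), uPrime v q.1 q.2 ≠ v ∧ vPrime v q.1 q.2 ≠ v ∧ q.1 ≠ v := by
  have hmeas : MeasurableSet {q : Space n × USphere n |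
      uPrime v q.1 q.2 ≠ v ∧ vPrime v q.1 q.2 ≠ v ∧ q.1 ≠ v} :=
    ((continuous_uPrime.comp (Continuous.prodMk_right v)).measurable
        (measurableSet_singleton v).compl).inter
      (((continuous_vPrime.comp (Continuous.prodMk_right v)).measurable
        (measurableSet_singleton v).compl).inter
        (measurable_fst (measurableSet_singleton v).compl))
  refine (Measure.ae_prod_iff_ae_ae hmeas).2 ((Measure.ae_ae_comm hmeas).2
    (Eventually.of_forall fun ω => ?_))
  have hω : (ω : Space n) ≠ 0 := ne_zero_of_mem_unit_sphere ω
  have hline : Submodule.span ℝ {(ω : Space n)} ≠ ⊤ := fun htop => by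
    have hrank := finrank_span_singleton (K := ℝ) hω
    rw [htop, finrank_top, finrank_euclideanSpace_fin] at hrank
    omega
  have hplane : (Submodule.span ℝ {(ω : Space n)})ᗮ ≠ ⊤ := by
    simpa [Submodule.orthogonal_eq_top_iff] using hω
  filter_upwards [ae_sub_notMem_submodule v hline, ae_sub_notMem_submodule v hplane]
    with u hu_line hu_plane
  refine ⟨fun h => hu_line (Submodule.mem_span_singleton.2 ⟨inner ℝ (u - v) ω, ?_⟩),
    fun h => hu_plane ?_, fun h => hu_line (by simp [h])⟩
  · rw [uPrime, sub_eq_iff_eq_add] at h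
    exact eq_sub_of_add_eq' h.symm
  · rw [vPrime, add_eq_left, smul_eq_zero, or_iff_left hω] at h
    rwa [Submodule.mem_orthogonal_singleton_iff_inner_left]

/-- In dimension at least two the value of `H` at the single velocity `v` enters the collision
integral at `v` through the loss term `H(u) H(v)` only. -/
lemma velocityCollision_of_eqOn_compl (hn : 2 ≤ n) {B : Kernel n} {v : Space n}
    (hB : Integrable (fun q => B v q.1 q.2) (collisionMeasure n)) {H ψ : Space n → ℝ} {r : ℝ}
    (hψ : Measurable ψ) (hr : ∀ w, |ψ w| ≤ r) (hHψ : EqOn H ψ {v}ᶜ) :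
    velocityCollision B H v = velocityCollision B ψ v +
      (ψ v - H v) * ∫ q, B v q.1 q.2 * ψ q.1 ∂(collisionMeasure n) := by
  have hint : Integrable (fun q => B v q.1 q.2 * ψ q.1) (collisionMeasure n) :=
    hB.mul_bdd (hψ.comp measurable_fst).aestronglyMeasurable
      (Eventually.of_forall fun q => hr q.1)
  rw [velocityCollision, velocityCollision, ← integral_const_mul,
    ← integral_add (integrable_kernel_mul_collisionBracket hB hψ hr) (hint.const_mul _)]
  refine integral_congr_ae ?_
  filter_upwards [ae_collision_ne hn v] with q ⟨hu', hv', hu⟩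
  simp only [collisionBracket, hHψ hu', hHψ hv', hHψ hu]
  ring

/-! ### Integration along backward trajectories -/

/-- The times `s > 0` such that the backward trajectory from `(x, v)` stays in `Ω` during `(0, s]`.
The position `x` itself may lie on the boundary, so that traces on `Γ₊` are values there; for
`v = 0` the set is empty by convention. -/
def backwardTimes (Ω : Set (Space n)) (x v : Space n) : Set ℝ :=
  {s | v ≠ 0 ∧ 0 < s ∧ ∀ r ∈ Ioc 0 s, x - r • v ∈ Ω}

lemma backwardTimes_zero (Ω : Set (Space n)) (x : Space n) : backwardTimes Ω x 0 = ∅ := by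
  simp [backwardTimes]

lemma isOpen_forall_mem_Icc_sub_smul_mem (hΩ : IsOpen Ω) (a b : ℝ) :
    IsOpen {q : (Space n × Space n) × ℝ | ∀ r ∈ Icc a b, q.1.1 - (r * q.2) • q.1.2 ∈ Ω} :=
  isOpen_iff_mem_nhds.2 fun q hq =>
    isCompact_Icc.eventually_forall_of_forall_eventually fun r hr =>
      (by fun_prop : ContinuousAt (fun a : ((Space n × Space n) × ℝ) × ℝ =>
        a.1.1.1 - (a.2 * a.1.2) • a.1.1.2) (q, r)).eventually_mem (hΩ.mem_nhds (hq r hr))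

lemma measurableSet_mem_backwardTimes (hΩ : IsOpen Ω) :
    MeasurableSet {q : (Space n × Space n) × ℝ | q.2 ∈ backwardTimes Ω q.1.1 q.1.2} := by
  have hne : MeasurableSet {q : (Space n × Space n) × ℝ | q.1.2 ≠ 0} :=
    (measurable_snd.comp measurable_fst) (measurableSet_singleton 0).compl
  have hpos : MeasurableSet {q : (Space n × Space n) × ℝ | 0 < q.2} :=
    measurable_snd measurableSet_Ioi
  convert hne.inter (hpos.inter (MeasurableSet.iInter fun k : ℕ =>
    (isOpen_forall_mem_Icc_sub_smul_mem hΩ (1 / ((k : ℝ) + 1)) 1).measurableSet)) using 1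
  ext ⟨⟨x, v⟩, s⟩
  simp only [backwardTimes, mem_ofPred_eq, mem_inter_iff, mem_iInter]
  refine and_congr_right fun _ => and_congr_right fun hs => ⟨fun h k r hr => ?_, fun h r hr => ?_⟩
  · have hr0 : 0 < r := Nat.one_div_pos_of_nat.trans_le hr.1
    exact h _ ⟨mul_pos hr0 hs, mul_le_of_le_one_left hs.le hr.2⟩
  · obtain ⟨k, hk⟩ := exists_nat_one_div_lt (div_pos hr.1 hs)
    simpa [div_mul_cancel₀ _ hs.ne'] using h k (r / s) ⟨hk.le, (div_le_one hs).2 hr.2⟩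

lemma measurableSet_backwardTimes (hΩ : IsOpen Ω) (x v : Space n) :
    MeasurableSet (backwardTimes Ω x v) :=
  measurable_prodMk_left (x := (x, v)) (measurableSet_mem_backwardTimes hΩ)

lemma volume_backwardTimes_lt_top (hΩ : Bornology.IsBounded Ω) (x v : Space n) :
    volume (backwardTimes Ω x v) < ∞ := by
  rcases eq_or_ne v 0 with rfl | hv
  · simp [backwardTimes_zero]
  obtain ⟨D, hD, hout⟩ := exists_forall_add_smul_notMem hΩ x hv
  refine (measure_mono fun s hs => ?_).trans_lt (measure_Icc_lt_top (a := 0) (b := D))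
  refine ⟨hs.2.1.le, not_lt.1 fun hDs => hout (-D) (by rw [abs_neg, abs_of_pos hD]) ?_⟩
  simpa [sub_eq_add_neg] using hs.2.2 D ⟨hD, hDs.le⟩

lemma volume_backwardTimes_le_tauMinus (Ω : Set (Space n)) (x v : Space n) :
    volume (backwardTimes Ω x v) ≤ tauMinus Ω x v := by
  rcases eq_or_ne (tauMinus Ω x v) ∞ with htop | htop
  · exact htop ▸ le_top
  have hsub : backwardTimes Ω x v ⊆ Ioc 0 (tauMinus Ω x v).toReal := fun s hs =>
    ⟨hs.2.1, (ENNReal.ofReal_le_iff_le_toReal htop).1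
      (le_iSup₂_of_le s ⟨hs.2.1.le, hs.2.2 s ⟨hs.2.1, le_rfl⟩⟩ le_rfl)⟩
  simpa [ENNReal.ofReal_toReal htop] using measure_mono (μ := volume) hsub

lemma backwardTimes_eq_empty_of_notMem_closure (hx : x ∉ closure Ω) : backwardTimes Ω x v = ∅ := by
  refine eq_empty_of_forall_notMem fun s hs => hx ?_
  have hlim : Tendsto (fun r : ℝ => x - r • v) (𝓝[>] 0) (𝓝 x) :=
    ((by fun_prop : Continuous fun r : ℝ => x - r • v).tendsto' 0 x (by simp)).mono_left
      nhdsWithin_le_nhds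
  exact mem_closure_of_tendsto hlim (mem_of_superset (Ioc_mem_nhdsGT hs.2.1) hs.2.2)

lemma volume_real_backwardTimes_pos (hΩ : Bornology.IsBounded Ω)
    (h : (x, v) ∈ transversalOutgoing Ω) : 0 < volume.real (backwardTimes Ω x v) := by
  obtain ⟨hout, T, hT, -, hmem⟩ := h
  have hsub : Ioo 0 T ⊆ backwardTimes Ω x v := fun s hs =>
    ⟨velocity_ne_zero_of_mem_outgoing hout, hs.1, fun r hr => hmem r ⟨hr.1, hr.2.trans_lt hs.2⟩⟩
  refine ENNReal.toReal_pos (ne_of_gt ?_) (volume_backwardTimes_lt_top hΩ x v).ne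
  exact (by simpa using hT : 0 < volume (Ioo 0 T)).trans_le (measure_mono hsub)

lemma backwardTimes_add_smul (hv : v ≠ 0) {t : ℝ} (ht : 0 ≤ t)
    (hseg : ∀ s ∈ Ico 0 t, x + s • v ∈ Ω) :
    backwardTimes Ω (x + t • v) v = Ioc 0 t ∪ (· - t) ⁻¹' backwardTimes Ω x v := by
  have hshift (r : ℝ) : x + t • v - r • v = x - (r - t) • v := by module
  have hback (r : ℝ) (hr : r ∈ Ioc 0 t) : x - (r - t) • v ∈ Ω := by
    simpa [sub_eq_add_neg, ← neg_smul] using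
      hseg (t - r) ⟨sub_nonneg.2 hr.2, sub_lt_self t hr.1⟩
  ext s
  simp only [backwardTimes, hshift, mem_ofPred_eq, mem_union, mem_preimage, sub_pos]
  constructor
  · rintro ⟨-, hs, h⟩
    refine (le_or_gt s t).imp (fun hst => ⟨hs, hst⟩) fun hst => ⟨hv, hst, fun r hr => ?_⟩
    simpa using h (r + t) ⟨by linarith [hr.1], by linarith [hr.2]⟩
  · rintro (hs | ⟨-, hts, h⟩)
    · exact ⟨hv, hs.1, fun r hr => hback r ⟨hr.1, hr.2.trans hs.2⟩⟩
    · refine ⟨hv, ht.trans_lt hts, fun r hr => ?_⟩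
      rcases le_or_gt r t with hrt | hrt
      · exact hback r ⟨hr.1, hrt⟩
      · exact h (r - t) ⟨sub_pos.2 hrt, sub_le_sub_right hr.2 t⟩

/-- The integral of the source `q` along the backward trajectory from `(x, v)` inside `Ω`: the
solution of `v · ∇ₓ f = q` with zero incoming data. -/
noncomputable def backwardIntegral (Ω : Set (Space n)) (q : Space n → Space n → ℝ)
    (x v : Space n) : ℝ :=
  ∫ s in backwardTimes Ω x v, q (x - s • v) v

section BackwardIntegral

variable {q q' : Space n → Space n → ℝ} {C C' : ℝ}

lemma measurable_backwardIntegral (hΩ : IsOpen Ω) (hq : Measurable (Function.uncurry q)) :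
    Measurable (Function.uncurry (backwardIntegral Ω q)) := by
  have hsource : Measurable fun a : (Space n × Space n) × ℝ => q (a.1.1 - a.2 • a.1.2) a.1.2 :=
    hq.comp (by fun_prop : Measurable fun a : (Space n × Space n) × ℝ =>
      (a.1.1 - a.2 • a.1.2, a.1.2))
  have hint := ((hsource.indicator (measurableSet_mem_backwardTimes hΩ)).stronglyMeasurable
    |>.integral_prod_right' (ν := volume)).measurable
  convert hint using 2 with p
  exact (integral_indicator (measurableSet_backwardTimes hΩ p.1 p.2)).symm

lemma integrableOn_backwardTimes (hΩ : Bornology.IsBounded Ω)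
    (hq : Measurable (Function.uncurry q)) (hC : ∀ y, |q y v| ≤ C) (x : Space n) :
    IntegrableOn (fun s : ℝ => q (x - s • v) v) (backwardTimes Ω x v) :=
  Measure.integrableOn_of_bounded (volume_backwardTimes_lt_top hΩ x v).ne
    (hq.comp (by fun_prop : Measurable fun s : ℝ => (x - s • v, v))).aestronglyMeasurable
    (Eventually.of_forall fun _ => hC _)

lemma abs_backwardIntegral_le (hΩ : Bornology.IsBounded Ω) (hC : ∀ y, |q y v| ≤ C) (x : Space n) :
    |backwardIntegral Ω q x v| ≤ C * volume.real (backwardTimes Ω x v) :=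
  norm_setIntegral_le_of_norm_le_const (f := fun s : ℝ => q (x - s • v) v)
    (volume_backwardTimes_lt_top hΩ x v) fun _ _ => hC _

lemma backwardIntegral_sub (hΩ : Bornology.IsBounded Ω) (hq : Measurable (Function.uncurry q))
    (hq' : Measurable (Function.uncurry q')) (hC : ∀ y, |q y v| ≤ C) (hC' : ∀ y, |q' y v| ≤ C')
    (x : Space n) :
    backwardIntegral Ω q x v - backwardIntegral Ω q' x v =
      backwardIntegral Ω (fun y w => q y w - q' y w) x v :=
  (integral_sub (integrableOn_backwardTimes hΩ hq hC x)
    (integrableOn_backwardTimes hΩ hq' hC' x)).symm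

lemma backwardIntegral_add_smul_sub (hΩ : IsOpen Ω) (hbdd : Bornology.IsBounded Ω)
    (hq : Measurable (Function.uncurry q)) (hC : ∀ y, |q y v| ≤ C) (hv : v ≠ 0) {t : ℝ}
    (ht : 0 ≤ t) (hseg : ∀ s ∈ Ico 0 t, x + s • v ∈ Ω) :
    backwardIntegral Ω q (x + t • v) v - backwardIntegral Ω q x v =
      ∫ s in (0 : ℝ)..t, q (x + s • v) v := by
  have hint := integrableOn_backwardTimes hbdd hq hC (x + t • v)
  have hdisj : Disjoint (Ioc 0 t) ((· - t) ⁻¹' backwardTimes Ω x v) :=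
    disjoint_left.2 fun s hs hs' => (sub_nonpos.2 hs.2).not_gt hs'.2.1
  have hmeas := (measurableSet_backwardTimes hΩ x v).preimage (measurable_id.sub_const t)
  have hnew : ∫ s in Ioc 0 t, q (x + t • v - s • v) v = ∫ s in (0 : ℝ)..t, q (x + s • v) v := by
    have hreverse := intervalIntegral.integral_comp_sub_left (fun s : ℝ => q (x + s • v) v) t
      (a := 0) (b := t)
    simp only [sub_self, sub_zero] at hreverse
    simp only [← hreverse, intervalIntegral.integral_of_le ht, sub_smul, add_sub_assoc]
  have hold : ∫ s in (· - t) ⁻¹' backwardTimes Ω x v, q (x + t • v - s • v) v =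
      backwardIntegral Ω q x v := by
    rw [backwardIntegral, ← (measurePreserving_sub_right volume t).setIntegral_preimage_emb
      (MeasurableEquiv.subRight t).measurableEmbedding (fun s => q (x - s • v) v)]
    simp only [sub_smul, sub_sub_eq_add_sub]
  rw [backwardTimes_add_smul hv ht hseg] at hint
  rw [sub_eq_iff_eq_add, ← hnew, ← hold, backwardIntegral, backwardTimes_add_smul hv ht hseg,
    setIntegral_union hdisj hmeas (hint.mono_set subset_union_left)
      (hint.mono_set subset_union_right)]

lemma tendsto_const_mul_nhdsGT_zero (C : ℝ) : Tendsto (fun t => C * t) (𝓝[>] 0) (𝓝 0) :=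
  ((continuous_const_mul C).tendsto' 0 0 (mul_zero C)).mono_left nhdsWithin_le_nhds

lemma tendsto_backwardIntegral_add_smul (hΩ : Bornology.IsBounded Ω) (hC : ∀ y, |q y v| ≤ C)
    (hx : x ∉ Ω) :
    Tendsto (fun t : ℝ => backwardIntegral Ω q (x + t • v) v) (𝓝[>] 0) (𝓝 0) := by
  refine squeeze_zero_norm' ?_ (tendsto_const_mul_nhdsGT_zero C)
  filter_upwards [self_mem_nhdsWithin] with t (ht : 0 < t)
  have hsub : backwardTimes Ω (x + t • v) v ⊆ Ioo 0 t := fun s hs =>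
    ⟨hs.2.1, not_le.1 fun hle => hx (by simpa using hs.2.2 t ⟨ht, hle⟩)⟩
  refine (abs_backwardIntegral_le hΩ hC _).trans
    (mul_le_mul_of_nonneg_left ?_ ((abs_nonneg _).trans (hC 0)))
  simpa [ht.le] using measureReal_mono (μ := volume) hsub measure_Ioo_lt_top.ne

lemma tendsto_backwardIntegral_sub_smul (hΩ : IsOpen Ω) (hbdd : Bornology.IsBounded Ω)
    (hq : Measurable (Function.uncurry q)) (hC : ∀ y, |q y v| ≤ C) (h : (x, v) ∈ outgoing Ω) :
    Tendsto (fun t : ℝ => backwardIntegral Ω q (x - t • v) v) (𝓝[>] 0)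
      (𝓝 (backwardIntegral Ω q x v)) := by
  obtain ⟨T, hT, hmem⟩ :=
    mem_nhdsGT_iff_exists_Ioc_subset.1 (eventually_sub_mem_of_mem_outgoing hΩ h)
  rw [tendsto_iff_norm_sub_tendsto_zero]
  refine squeeze_zero' (Eventually.of_forall fun _ => norm_nonneg _) ?_
    (tendsto_const_mul_nhdsGT_zero C)
  filter_upwards [Ioc_mem_nhdsGT hT] with t ht
  have hseg : ∀ s ∈ Ico 0 t, x - t • v + s • v ∈ Ω := fun s hs => by
    have h' := hmem (⟨sub_pos.2 hs.2, by linarith [hs.1, ht.2]⟩ : t - s ∈ Ioc 0 T)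
    simpa [sub_smul, sub_add] using h'
  have htrace := backwardIntegral_add_smul_sub hΩ hbdd hq hC
    (velocity_ne_zero_of_mem_outgoing h) ht.1.le hseg
  rw [sub_add_cancel] at htrace
  rw [norm_sub_rev, htrace]
  simpa [abs_of_pos ht.1] using intervalIntegral.norm_integral_le_of_norm_le_const
    (f := fun s : ℝ => q (x - t • v + s • v) v) fun s (_ : s ∈ uIoc 0 t) => hC _

end BackwardIntegral

/-! ### Solutions with small data depending on the velocity only -/

lemma exists_measurable_isFixedPt {α : Type*} [MeasurableSpace α] {r : ℝ} (hr : 0 ≤ r)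
    {T : (α → ℝ) → α → ℝ} (hmeas : ∀ f, Measurable f → (∀ a, |f a| ≤ r) → Measurable (T f))
    (hbound : ∀ f, Measurable f → (∀ a, |f a| ≤ r) → ∀ a, |T f a| ≤ r) {k : NNReal} (hk : k < 1)
    (hdist : ∀ f g, Measurable f → Measurable g → (∀ a, |f a| ≤ r) → (∀ a, |g a| ≤ r) →
      ∀ d, (∀ a, |f a - g a| ≤ d) → ∀ a, |T f a - T g a| ≤ k * d) :
    ∃ f, Measurable f ∧ (∀ a, |f a| ≤ r) ∧ Function.IsFixedPt T f := by
  let S : Set (UniformFun α ℝ) :=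
    {f | Measurable (UniformFun.toFun f) ∧ ∀ a, |UniformFun.toFun f a| ≤ r}
  have hS : IsClosed S := IsSeqClosed.isClosed fun f g hf hfg => by
    have hlim (a : α) := (UniformFun.tendsto_iff_tendstoUniformly.1 hfg).tendsto_at a
    exact ⟨measurable_of_tendsto_metrizable (fun j => (hf j).1) (tendsto_pi_nhds.2 hlim),
      fun a => le_of_tendsto (hlim a).abs (Eventually.of_forall fun j => (hf j).2 a)⟩
  let U : UniformFun α ℝ → UniformFun α ℝ := fun f => UniformFun.ofFun (T (UniformFun.toFun f))
  have hU : MapsTo U S S := fun f hf => ⟨hmeas _ hf.1 hf.2, hbound _ hf.1 hf.2⟩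
  have hfinite (f g : S) : edist f g ≠ ∞ := by
    refine ne_top_of_le_ne_top (ENNReal.ofReal_ne_top (r := r + r)) (UniformFun.edist_le.2
      fun a => ?_)
    rw [edist_dist, Real.dist_eq]
    exact ENNReal.ofReal_le_ofReal ((abs_sub _ _).trans (add_le_add (f.2.2 a) (g.2.2 a)))
  have hcontr : ContractingWith k (hU.restrict U S S) := by
    refine ⟨hk, fun f g => UniformFun.edist_le.2 fun a => ?_⟩
    have hd (b : α) : |UniformFun.toFun f.1 b - UniformFun.toFun g.1 b| ≤ (edist f g).toReal := by
      rw [← Real.dist_eq, dist_edist]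
      exact ENNReal.toReal_mono (hfinite f g) UniformFun.edist_eval_le
    rw [edist_dist, Real.dist_eq]
    refine (ENNReal.ofReal_le_ofReal (hdist _ _ f.2.1 g.2.1 f.2.2 g.2.2 _ hd a)).trans_eq ?_
    rw [ENNReal.ofReal_mul k.coe_nonneg, ENNReal.ofReal_toReal (hfinite f g),
      ENNReal.ofReal_coe_nnreal]
  have h0 : UniformFun.ofFun (fun _ : α => (0 : ℝ)) ∈ S :=
    ⟨measurable_const, fun _ => by simpa using hr⟩
  obtain ⟨f, hf, hfix, -⟩ :=
    hcontr.exists_fixedPoint' hS.isComplete hU h0 (hfinite ⟨_, h0⟩ ⟨_, hU h0⟩)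
  exact ⟨UniformFun.toFun f, hf.1, hf.2, hfix⟩

/-- A continuous kernel whose collision mass, times the time spent in `Ω` since the entrance, is at
most `M`: what the transport estimates use of assumption (a). -/
structure IsAdmissibleKernel (Ω : Set (Space n)) (B : Kernel n) (M : ℝ) : Prop where
  continuous : IsContinuousKernel B
  integrable : ∀ v, v ≠ 0 → Integrable (fun q => B v q.1 q.2) (collisionMeasure n)
  volume_mul_le : ∀ x v,
    volume.real (backwardTimes Ω x v) * ∫ q, ‖B v q.1 q.2‖ ∂(collisionMeasure n) ≤ M

lemma exists_tauMinus_ne_zero (hΩ : IsOpen Ω) (hne : Ω.Nonempty) (v : Space n) :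
    ∃ x ∈ Ω, tauMinus Ω x v ≠ 0 := by
  obtain ⟨x, hx⟩ := hne
  obtain ⟨s, hs, hpos⟩ :=
    ((eventually_add_smul_mem (hΩ.mem_nhds hx) (-v)).and self_mem_nhdsWithin).exists
  refine ⟨x, hx, ((ENNReal.ofReal_pos.2 hpos).trans_le (le_iSup₂_of_le s ⟨?_, ?_⟩ le_rfl)).ne'⟩
  · exact (show (0 : ℝ) < s from hpos).le
  · simpa [sub_eq_add_neg] using hs

lemma IsContinuousKernel.kernelMass_eq_lintegral {B : Kernel n} (hB : IsContinuousKernel B)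
    (v : Space n) : kernelMass B v = ∫⁻ q, ‖B v q.1 q.2‖ₑ ∂(collisionMeasure n) :=
  (lintegral_prod _ (hB.continuous_fixed v).enorm.measurable.aemeasurable).symm

lemma KernelBound.exists_isAdmissibleKernel (hΩ : IsOpen Ω) (hne : Ω.Nonempty) {B : Kernel n}
    (hB : IsContinuousKernel B) (h : KernelBound Ω B) : ∃ M, IsAdmissibleKernel Ω B M := by
  obtain ⟨M, hM, hbound⟩ := h
  refine ⟨M, hB, fun v hv => ⟨(hB.continuous_fixed v).aestronglyMeasurable, ?_⟩, fun x v => ?_⟩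
  · obtain ⟨x, hx, hτ⟩ := exists_tauMinus_ne_zero hΩ hne v
    rw [HasFiniteIntegral, ← hB.kernelMass_eq_lintegral, lt_top_iff_ne_top]
    intro htop
    have hτtop := (hbound x (subset_closure hx) v hv).2
    rw [htop, ENNReal.mul_top hτ] at hτtop
    exact not_top_lt hτtop
  · rcases eq_or_ne v 0 with rfl | hv
    · simpa [backwardTimes_zero] using hM.le
    by_cases hx : x ∈ closure Ω
    · rw [integral_norm_eq_lintegral_enorm (hB.continuous_fixed v).aestronglyMeasurable,
        ← hB.kernelMass_eq_lintegral, measureReal_def, ← ENNReal.toReal_mul]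
      refine ENNReal.toReal_le_of_le_ofReal hM.le (le_trans ?_ (hbound x hx v hv).2.le)
      gcongr
      exact volume_backwardTimes_le_tauMinus Ω x v
    · simpa [backwardTimes_eq_empty_of_notMem_closure hx] using hM.le

/-- The right-hand side of the integrated equation with incoming datum `φ(v)`. -/
noncomputable def duhamel (Ω : Set (Space n)) (B : Kernel n) (φ : Space n → ℝ)
    (F : Space n → Space n → ℝ) (x v : Space n) : ℝ :=
  φ v + backwardIntegral Ω (fun y w => velocityCollision B (F y) w) x v

section Duhamel

variable {B : Kernel n} {M r d : ℝ} {φ : Space n → ℝ} {F K : Space n → Space n → ℝ}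

lemma measurable_duhamel (hΩ : IsOpen Ω) (hB : IsContinuousKernel B) (hφ : Measurable φ)
    (hF : Measurable (Function.uncurry F)) :
    Measurable (Function.uncurry (duhamel Ω B φ F)) :=
  (hφ.comp measurable_snd).add
    (measurable_backwardIntegral hΩ (measurable_velocityCollision hB hF))

lemma duhamel_const (Ω : Set (Space n)) (B : Kernel n) (φ ψ : Space n → ℝ) (x v : Space n) :
    duhamel Ω B φ (fun _ => ψ) x v =
      φ v + volume.real (backwardTimes Ω x v) * velocityCollision B ψ v := by
  simp [duhamel, backwardIntegral]

lemma abs_duhamel_sub_le (hΩ : Bornology.IsBounded Ω) (hB : IsAdmissibleKernel Ω B M)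
    (hF : Measurable (Function.uncurry F)) (hK : Measurable (Function.uncurry K))
    (hFr : ∀ x w, |F x w| ≤ r) (hKr : ∀ x w, |K x w| ≤ r) (hFK : ∀ x w, |F x w - K x w| ≤ d)
    (x v : Space n) :
    |duhamel Ω B φ F x v - duhamel Ω B φ K x v| ≤ 4 * r * d * M := by
  have hr : 0 ≤ r := (abs_nonneg _).trans (hFr 0 0)
  have hd : 0 ≤ d := (abs_nonneg _).trans (hFK 0 0)
  have hmass := mul_le_mul_of_nonneg_left (hB.volume_mul_le x v) (by positivity : 0 ≤ 4 * r * d)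
  rw [duhamel, duhamel, add_sub_add_left_eq_sub]
  rcases eq_or_ne v 0 with rfl | hv
  · simpa [backwardIntegral, backwardTimes_zero] using hmass
  have hint := hB.integrable v hv
  rw [backwardIntegral_sub hΩ (measurable_velocityCollision hB.continuous hF)
    (measurable_velocityCollision hB.continuous hK)
    (fun y => abs_velocityCollision_le hint hF.of_uncurry_left (hFr y))
    (fun y => abs_velocityCollision_le hint hK.of_uncurry_left (hKr y))]
  refine (abs_backwardIntegral_le hΩ (fun y => abs_velocityCollision_sub_le hint
    hF.of_uncurry_left hK.of_uncurry_left (hFr y) (hKr y) (hFK y)) x).trans ?_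
  linarith

lemma abs_duhamel_sub_datum_le (hΩ : Bornology.IsBounded Ω) (hB : IsAdmissibleKernel Ω B M)
    (hF : Measurable (Function.uncurry F)) (hFr : ∀ x w, |F x w| ≤ r) (x v : Space n) :
    |duhamel Ω B φ F x v - φ v| ≤ 4 * r * r * M := by
  have hr : 0 ≤ r := (abs_nonneg _).trans (hFr 0 0)
  simpa [duhamel_const, velocityCollision, collisionBracket] using
    abs_duhamel_sub_le (φ := φ) hΩ hB hF (K := fun _ _ => 0)
      measurable_const hFr (by simpa using hr) (by simpa using hFr) x v

/-- A solution `F` of the integrated equation with incoming datum `φ(v)` and `|F| ≤ r`, at all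
positions, including those on the boundary and outside `Ω`. -/
structure IsMildSolution (Ω : Set (Space n)) (B : Kernel n) (φ : Space n → ℝ) (r : ℝ)
    (F : Space n → Space n → ℝ) : Prop where
  measurable : Measurable (Function.uncurry F)
  bound : ∀ x v, |F x v| ≤ r
  duhamel_eq : ∀ x v, duhamel Ω B φ F x v = F x v

lemma exists_isMildSolution (hΩ : IsOpen Ω) (hbdd : Bornology.IsBounded Ω)
    (hB : IsAdmissibleKernel Ω B M) (hφ : Measurable φ) {l : ℝ} (hφl : ∀ w, |φ w| ≤ l)
    (hl : 16 * M * l ≤ 1) : ∃ F, IsMildSolution Ω B φ (2 * l) F := by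
  have hl0 : 0 ≤ l := (abs_nonneg _).trans (hφl 0)
  let T (f : Space n × Space n → ℝ) := Function.uncurry (duhamel Ω B φ (Function.curry f))
  have hT (f) (hf : Measurable f) (hfl : ∀ p, |f p| ≤ 2 * l) (p) : |T f p| ≤ 2 * l := by
    have hdist : |T f p - φ p.2| ≤ 4 * (2 * l) * (2 * l) * M :=
      abs_duhamel_sub_datum_le hbdd hB (F := Function.curry f) hf (fun x w => hfl (x, w)) p.1 p.2
    have hsmall : 4 * (2 * l) * (2 * l) * M ≤ l := by nlinarith
    linarith [abs_sub_abs_le_abs_sub (T f p) (φ p.2), hφl p.2]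
  obtain ⟨f, hf, hfl, hfix⟩ := exists_measurable_isFixedPt (T := T) (k := 2⁻¹) (by positivity)
    (fun f hf _ => measurable_duhamel hΩ hB.continuous hφ hf) hT
    (by norm_num) fun f g hf hg hfl hgl d hd p => by
      have hd0 : 0 ≤ d := (abs_nonneg _).trans (hd 0)
      refine (abs_duhamel_sub_le (F := Function.curry f) (K := Function.curry g) hbdd hB hf hg
        (fun x w => hfl (x, w)) (fun x w => hgl (x, w)) (fun x w => hd (x, w)) p.1 p.2).trans ?_
      push_cast
      nlinarith
  exact ⟨Function.curry f, hf, fun x v => hfl (x, v), fun x v => congrFun hfix (x, v)⟩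

namespace IsMildSolution

lemma abs_velocityCollision_le (h : IsMildSolution Ω B φ r F) (hB : IsAdmissibleKernel Ω B M)
    (hv : v ≠ 0) (y : Space n) : |velocityCollision B (F y) v| ≤
      4 * r * r * ∫ q, ‖B v q.1 q.2‖ ∂(collisionMeasure n) :=
  Boltzmann.abs_velocityCollision_le (hB.integrable v hv) h.measurable.of_uncurry_left (h.bound y)

lemma isSmallSolution (h : IsMildSolution Ω B φ r F) (hΩ : IsOpen Ω)
    (hbdd : Bornology.IsBounded Ω) (hB : IsAdmissibleKernel Ω B M) :
    IsSmallSolution Ω B r (fun p => φ p.2) F := by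
  refine ⟨h.measurable, fun x _ => h.bound x, fun x _ v hv t ht hseg => ?_, fun ⟨x, v⟩ hp => ?_⟩
  · rw [← h.duhamel_eq, ← h.duhamel_eq, duhamel, duhamel, add_sub_add_left_eq_sub,
      backwardIntegral_add_smul_sub hΩ hbdd
        (measurable_velocityCollision hB.continuous h.measurable)
        (h.abs_velocityCollision_le hB hv) hv ht fun s hs => hseg s (Ico_subset_Icc_self hs)]
    exact intervalIntegral.integral_congr fun s _ => (collision_eq_velocityCollision
      (hB.integrable v hv) h.measurable.of_uncurry_left (h.bound _)).symm
  · have hv : v ≠ 0 := by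
      simpa using velocity_ne_zero_of_mem_outgoing (mem_incoming_iff_neg_mem_outgoing.1 hp)
    have hx : x ∉ Ω := (hΩ.frontier_eq ▸ hp.1 : x ∈ closure Ω \ Ω).2
    simpa only [duhamel, add_zero, ← h.duhamel_eq] using
      (tendsto_backwardIntegral_add_smul hbdd (h.abs_velocityCollision_le hB hv) hx).const_add (φ v)

lemma tendsto_trace (h : IsMildSolution Ω B φ r F) (hΩ : IsOpen Ω) (hbdd : Bornology.IsBounded Ω)
    (hB : IsAdmissibleKernel Ω B M) (hp : (x, v) ∈ outgoing Ω) :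
    Tendsto (fun t : ℝ => F (x - t • v) v) (𝓝[>] 0) (𝓝 (F x v)) := by
  simpa only [duhamel, ← h.duhamel_eq] using (tendsto_backwardIntegral_sub_smul hΩ hbdd
    (measurable_velocityCollision hB.continuous h.measurable)
    (h.abs_velocityCollision_le hB (velocity_ne_zero_of_mem_outgoing hp)) hp).const_add (φ v)

lemma abs_sub_expansion_le {l : ℝ} (h : IsMildSolution Ω B φ (2 * l) F)
    (hbdd : Bornology.IsBounded Ω) (hB : IsAdmissibleKernel Ω B M) (hφ : Measurable φ)
    (hφl : ∀ w, |φ w| ≤ l) (x v : Space n) :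
    |F x v - (φ v + volume.real (backwardTimes Ω x v) * velocityCollision B φ v)| ≤
      128 * M ^ 2 * l ^ 3 := by
  have hfirst (y w : Space n) : |F y w - φ w| ≤ 4 * (2 * l) * (2 * l) * M := by
    simpa only [h.duhamel_eq] using
      abs_duhamel_sub_datum_le (φ := φ) hbdd hB h.measurable h.bound y w
  have hφ2l (w : Space n) : |φ w| ≤ 2 * l := by linarith [abs_nonneg (φ w), hφl w]
  have hsecond := abs_duhamel_sub_le (φ := φ) (K := fun _ => φ) hbdd hB h.measurable
    (hφ.comp measurable_snd) h.bound (fun _ => hφ2l) hfirst x v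
  rw [h.duhamel_eq, duhamel_const] at hsecond
  linarith

end IsMildSolution

lemma exists_isMeasurement (hΩ : IsOpen Ω) (hbdd : Bornology.IsBounded Ω)
    (hB : IsAdmissibleKernel Ω B M) (hφ : Measurable φ) {l : ℝ} (hφl : ∀ w, |φ w| ≤ l)
    (hl : 16 * M * l ≤ 1) {δ : ℝ} (hδ : 2 * l ≤ δ) :
    ∃ h, IsMeasurement Ω B δ (fun p => φ p.2) h ∧ ∀ x v,
      |h (x, v) - (φ v + volume.real (backwardTimes Ω x v) * velocityCollision B φ v)| ≤
        128 * M ^ 2 * l ^ 3 := by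
  obtain ⟨F, hF⟩ := exists_isMildSolution hΩ hbdd hB hφ hφl hl
  have hsol := hF.isSmallSolution hΩ hbdd hB
  exact ⟨Function.uncurry F, ⟨F, ⟨hsol.measurable, fun x hx v => (hsol.bound x hx v).trans hδ,
    hsol.transport, hsol.inflow⟩, fun p hp => hF.tendsto_trace hΩ hbdd hB hp⟩,
    hF.abs_sub_expansion_le hbdd hB hφ hφl⟩

end Duhamel

/-! ### Recovery of the kernel -/

lemma eq_zero_of_eventually_sq_mul_abs_le {a C : ℝ}
    (h : ∀ᶠ l in 𝓝[>] (0 : ℝ), l ^ 2 * |a| ≤ C * l ^ 3) : a = 0 := by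
  refine abs_nonpos_iff.1 (ge_of_tendsto (tendsto_const_mul_nhdsGT_zero C) ?_)
  filter_upwards [h, self_mem_nhdsWithin] with l hl hpos
  exact le_of_mul_le_mul_left (by linarith) (pow_pos hpos 2)

lemma eq_zero_of_forall_integral_mul_eq_zero {α : Type*} [TopologicalSpace α]
    [MeasurableSpace α] [OpensMeasurableSpace α] {μ : Measure α} [μ.IsOpenPosMeasure]
    {f : α → ℝ} (hf : Continuous f) (hint : Integrable f μ)
    (h : ∀ ψ : α → ℝ, Continuous ψ → (∀ a, |ψ a| ≤ 1) → ∫ a, f a * ψ a ∂μ = 0) : f = 0 := by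
  let ψ (a : α) : ℝ := f a / (1 + |f a|)
  have hpos (a : α) : 0 < 1 + |f a| := by positivity
  have hψ : Continuous ψ := hf.div (by fun_prop) fun a => (hpos a).ne'
  have hψ1 (a : α) : |ψ a| ≤ 1 := by
    rw [abs_div, abs_of_pos (hpos a), div_le_one (hpos a)]
    linarith
  have hnonneg (a : α) : 0 ≤ f a * ψ a := by
    rw [← mul_div_assoc]
    exact div_nonneg (mul_self_nonneg _) (hpos a).le
  have hzero := (integral_eq_zero_iff_of_nonneg hnonneg (hint.mul_bdd
    hψ.measurable.aestronglyMeasurable (Eventually.of_forall hψ1))).1 (h ψ hψ hψ1)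
  funext a
  have ha := congrFun ((Continuous.ae_eq_iff_eq μ (hf.mul hψ) continuous_zero).1 hzero) a
  simpa [ψ, (hpos a).ne'] using ha

lemma eq_of_le_of_integral_eq {α : Type*} [TopologicalSpace α] [MeasurableSpace α]
    {μ : Measure α} [μ.IsOpenPosMeasure] {f g : α → ℝ} (hf : Continuous f)
    (hg : Continuous g) (hfi : Integrable f μ) (hgi : Integrable g μ) (hle : f ≤ g)
    (h : ∫ a, f a ∂μ = ∫ a, g a ∂μ) : f = g :=
  (Continuous.ae_eq_iff_eq μ hf hg).1
    ((integral_eq_iff_of_ae_le hfi hgi (Eventually.of_forall hle)).1 h)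

lemma IsContinuousKernel.continuous_integral_sphere {B : Kernel n} (hB : IsContinuousKernel B)
    (v : Space n) : Continuous fun u => ∫ ω, B v u ω ∂(sphereMeasure n) := by
  simpa only [setIntegral_univ] using
    continuous_parametric_integral_of_continuous (μ := sphereMeasure n)
      (f := fun u ω => B v u ω) (hB.continuous_fixed v) isCompact_univ

lemma IsContinuousKernel.eq_of_forall_ne_zero (hn : 0 < n) {B₁ B₂ : Kernel n}
    (hB₁ : IsContinuousKernel B₁) (hB₂ : IsContinuousKernel B₂)
    (h : ∀ v, v ≠ 0 → B₁ v = B₂ v) : B₁ = B₂ := by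
  have : Nonempty (Fin n) := ⟨⟨0, hn⟩⟩
  funext v u ω
  have hc {B : Kernel n} (hB : IsContinuousKernel B) : Continuous fun w => B w u ω :=
    hB.comp (by fun_prop : Continuous fun w : Space n => (w, u, ω))
  exact congrFun ((hc hB₁).ext_on (dense_compl_singleton (0 : Space n)) (hc hB₂)
    fun w hw => congrFun₂ (h w hw) u ω) v

namespace SameMeasurements

variable {B₁ B₂ : Kernel n} {M₁ M₂ : ℝ}

lemma eventually_abs_velocityCollision_sub_le (hmeas : SameMeasurements Ω B₁ B₂)
    (hΩ : IsOpen Ω) (hbdd : Bornology.IsBounded Ω) (hB₁ : IsAdmissibleKernel Ω B₁ M₁)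
    (hB₂ : IsAdmissibleKernel Ω B₂ M₂) (hx : (x, v) ∈ transversalOutgoing Ω) :
    ∀ᶠ l in 𝓝 (0 : ℝ), ∀ φ : Space n → ℝ, Continuous φ → (∀ w, |φ w| ≤ l) →
      volume.real (backwardTimes Ω x v) * |velocityCollision B₁ φ v - velocityCollision B₂ φ v| ≤
        128 * (M₁ ^ 2 + M₂ ^ 2) * l ^ 3 := by
  obtain ⟨ε, hε, δ, hδ, hsame⟩ := hmeas
  have hsmall (c : ℝ) {η : ℝ} (hη : 0 < η) : ∀ᶠ l in 𝓝 (0 : ℝ), c * l ≤ η :=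
    ((continuous_const_mul c).tendsto' 0 0 (mul_zero c)).eventually_le_const hη
  filter_upwards [hsmall (16 * M₁) one_pos, hsmall (16 * M₂) one_pos, hsmall 2 hδ,
    eventually_le_nhds hε] with l hM₁ hM₂ hlδ hlε φ hφ hφl
  obtain ⟨h₁, hh₁, hexp₁⟩ := exists_isMeasurement hΩ hbdd hB₁ hφ.measurable hφl hM₁ hlδ
  obtain ⟨h₂, hh₂, hexp₂⟩ := exists_isMeasurement hΩ hbdd hB₂ hφ.measurable hφl hM₂ hlδ
  have heq : h₁ (x, v) = h₂ (x, v) := hsame (fun p => φ p.2)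
    (hφ.comp continuous_snd).continuousOn (fun p _ => (hφl p.2).trans hlε) h₁ h₂ hh₁ hh₂ hx
  have hclose := (abs_sub_le _ (h₁ (x, v)) _).trans
    (add_le_add ((abs_sub_comm _ _).trans_le (hexp₁ x v)) (heq ▸ hexp₂ x v))
  rw [add_sub_add_left_eq_sub, ← mul_sub, abs_mul, abs_of_nonneg measureReal_nonneg] at hclose
  linarith

lemma velocityCollision_eq (hmeas : SameMeasurements Ω B₁ B₂) (hΩ : IsSmoothBoundedDomain Ω)
    (hB₁ : IsAdmissibleKernel Ω B₁ M₁) (hB₂ : IsAdmissibleKernel Ω B₂ M₂) (hv : v ≠ 0)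
    {φ : Space n → ℝ} (hφ : Continuous φ) {r : ℝ} (hr : ∀ w, |φ w| ≤ r) :
    velocityCollision B₁ φ v = velocityCollision B₂ φ v := by
  obtain ⟨x, hx⟩ := exists_mem_transversalOutgoing hΩ hv
  set T := volume.real (backwardTimes Ω x v)
  have hT : 0 < T := volume_real_backwardTimes_pos hΩ.isBounded hx
  have hscale : Tendsto (fun l : ℝ => l * r) (𝓝[>] 0) (𝓝 0) := by
    simpa only [mul_comm] using tendsto_const_mul_nhdsGT_zero r
  have hexpand := hscale.eventually
    (hmeas.eventually_abs_velocityCollision_sub_le hΩ.isOpen hΩ.isBounded hB₁ hB₂ hx)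
  refine sub_eq_zero.1 (eq_zero_of_eventually_sq_mul_abs_le
    (C := 128 * (M₁ ^ 2 + M₂ ^ 2) * r ^ 3 / T) ?_)
  filter_upwards [hexpand, self_mem_nhdsWithin] with l hl (hpos : 0 < l)
  have hlφ (w : Space n) : |l * φ w| ≤ l * r := by
    rw [abs_mul, abs_of_pos hpos]
    exact mul_le_mul_of_nonneg_left (hr w) hpos.le
  have hbound := hl (fun w => l * φ w) (hφ.const_mul l) hlφ
  rw [velocityCollision_const_mul, velocityCollision_const_mul, ← mul_sub, abs_mul,
    abs_of_nonneg (sq_nonneg l)] at hbound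
  rw [div_mul_eq_mul_div, le_div_iff₀ hT]
  linarith

lemma velocityCollision_add_indicator_eq (hmeas : SameMeasurements Ω B₁ B₂)
    (hΩ : IsSmoothBoundedDomain Ω) (hB₁ : IsAdmissibleKernel Ω B₁ M₁)
    (hB₂ : IsAdmissibleKernel Ω B₂ M₂) (hv : v ≠ 0) {ψ : Space n → ℝ} (hψ : Continuous ψ) {r : ℝ}
    (hr : ∀ w, |ψ w| ≤ r) :
    velocityCollision B₁ (ψ + indicator {v} 1) v =
      velocityCollision B₂ (ψ + indicator {v} 1) v := by
  have hpos (k : ℕ) : 0 < 1 / ((k : ℝ) + 1) := Nat.one_div_pos_of_nat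
  let H (k : ℕ) (w : Space n) : ℝ := ψ w + thickenedIndicator (hpos k) {v} w
  have hH (k : ℕ) : Continuous (H k) := by fun_prop
  have hHr (k : ℕ) (w : Space n) : |H k w| ≤ r + 1 := by
    refine (abs_add_le _ _).trans (add_le_add (hr w) ?_)
    rw [NNReal.abs_eq]
    exact_mod_cast thickenedIndicator_le_one (hpos k) {v} w
  have hlim (w : Space n) :
      Tendsto (fun k => H k w) atTop (𝓝 ((ψ + indicator {v} 1 : Space n → ℝ) w)) := by
    have h := tendsto_pi_nhds.1 (thickenedIndicator_tendsto_indicator_closure hpos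
      tendsto_one_div_add_atTop_nhds_zero_nat {v}) w
    have hcoe := (NNReal.tendsto_coe.2 h).const_add (ψ w)
    by_cases hw : w = v <;> simpa [H, hw] using hcoe
  have htendsto {B : Kernel n} {M : ℝ} (hB : IsAdmissibleKernel Ω B M) :=
    tendsto_velocityCollision (hB.integrable v hv) (fun k => (hH k).measurable) hHr hlim
  refine tendsto_nhds_unique (htendsto hB₁) ((htendsto hB₂).congr fun k => ?_)
  exact (hmeas.velocityCollision_eq hΩ hB₁ hB₂ hv (hH k) (hHr k)).symm

lemma integral_mul_eq (hmeas : SameMeasurements Ω B₁ B₂) (hn : 2 ≤ n)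
    (hΩ : IsSmoothBoundedDomain Ω) (hB₁ : IsAdmissibleKernel Ω B₁ M₁)
    (hB₂ : IsAdmissibleKernel Ω B₂ M₂) (hv : v ≠ 0) {ψ : Space n → ℝ} (hψ : Continuous ψ) {r : ℝ}
    (hr : ∀ w, |ψ w| ≤ r) :
    ∫ q, B₁ v q.1 q.2 * ψ q.1 ∂(collisionMeasure n) =
      ∫ q, B₂ v q.1 q.2 * ψ q.1 ∂(collisionMeasure n) := by
  have hspike {B : Kernel n} {M : ℝ} (hB : IsAdmissibleKernel Ω B M) :
      velocityCollision B (ψ + indicator {v} 1) v = velocityCollision B ψ v -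
        ∫ q, B v q.1 q.2 * ψ q.1 ∂(collisionMeasure n) := by
    rw [velocityCollision_of_eqOn_compl hn (hB.integrable v hv) hψ.measurable hr
      fun w hw => by rw [Pi.add_apply, indicator_of_notMem hw, add_zero]]
    simp [sub_eq_add_neg]
  have h := hmeas.velocityCollision_add_indicator_eq hΩ hB₁ hB₂ hv hψ hr
  rw [hspike hB₁, hspike hB₂, hmeas.velocityCollision_eq hΩ hB₁ hB₂ hv hψ hr] at h
  exact sub_right_injective h

lemma integral_sphere_eq (hmeas : SameMeasurements Ω B₁ B₂) (hn : 2 ≤ n)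
    (hΩ : IsSmoothBoundedDomain Ω) (hB₁ : IsAdmissibleKernel Ω B₁ M₁)
    (hB₂ : IsAdmissibleKernel Ω B₂ M₂) (hv : v ≠ 0) (u : Space n) :
    ∫ ω, B₁ v u ω ∂(sphereMeasure n) = ∫ ω, B₂ v u ω ∂(sphereMeasure n) := by
  let b (B : Kernel n) (u : Space n) : ℝ := ∫ ω, B v u ω ∂(sphereMeasure n)
  have hb {B : Kernel n} {M : ℝ} (hB : IsAdmissibleKernel Ω B M) : Integrable (b B) :=
    (hB.integrable v hv).integral_prod_left
  have hbψ {B : Kernel n} {M : ℝ} (hB : IsAdmissibleKernel Ω B M) {ψ : Space n → ℝ}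
      (hψ : Continuous ψ) (hψ1 : ∀ w, |ψ w| ≤ 1) :
      ∫ u, b B u * ψ u = ∫ q, B v q.1 q.2 * ψ q.1 ∂(collisionMeasure n) := by
    simp only [b, ← integral_mul_const]
    exact (integral_prod (fun q => B v q.1 q.2 * ψ q.1) ((hB.integrable v hv).mul_bdd
      (hψ.measurable.comp measurable_fst).aestronglyMeasurable
      (Eventually.of_forall fun q => hψ1 q.1))).symm
  have hzero : b B₁ - b B₂ = 0 := by
    refine eq_zero_of_forall_integral_mul_eq_zero
      ((hB₁.continuous.continuous_integral_sphere v).sub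
        (hB₂.continuous.continuous_integral_sphere v)) ((hb hB₁).sub (hb hB₂)) fun ψ hψ hψ1 => ?_
    have hmul {B : Kernel n} {M : ℝ} (hB : IsAdmissibleKernel Ω B M) :
        Integrable fun u => b B u * ψ u :=
      (hb hB).mul_bdd hψ.measurable.aestronglyMeasurable (Eventually.of_forall hψ1)
    simp only [Pi.sub_apply, sub_mul]
    rw [integral_sub (hmul hB₁) (hmul hB₂), hbψ hB₁ hψ hψ1, hbψ hB₂ hψ hψ1,
      hmeas.integral_mul_eq hn hΩ hB₁ hB₂ hv hψ hψ1, sub_self]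
  exact congrFun (sub_eq_zero.1 hzero) u

end SameMeasurements

lemma IsContinuousKernel.eq_of_le_of_integral_sphere_eq {B₁ B₂ : Kernel n}
    (hB₁ : IsContinuousKernel B₁) (hB₂ : IsContinuousKernel B₂) {u : Space n}
    (hle : B₁ v u ≤ B₂ v u)
    (h : ∫ ω, B₁ v u ω ∂(sphereMeasure n) = ∫ ω, B₂ v u ω ∂(sphereMeasure n)) :
    B₁ v u = B₂ v u := by
  have hc {B : Kernel n} (hB : IsContinuousKernel B) : Continuous (B v u) :=
    (hB.continuous_fixed v).comp (Continuous.prodMk_right u)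
  have hi {B : Kernel n} (hB : IsContinuousKernel B) : Integrable (B v u) (sphereMeasure n) :=
    (hc hB).integrable_of_hasCompactSupport (HasCompactSupport.of_compactSpace _)
  exact eq_of_le_of_integral_eq (hc hB₁) (hc hB₂) (hi hB₁) (hi hB₂) hle h

end Boltzmann

theorem corollary1p3_general (n : ℕ) (hn : 2 ≤ n) (Ω : Set (Boltzmann.Space n))
    (hΩ : Boltzmann.IsSmoothBoundedDomain Ω) (B₁ B₂ : Boltzmann.Kernel n)
    (hcont₁ : Boltzmann.IsContinuousKernel B₁) (hcont₂ : Boltzmann.IsContinuousKernel B₂)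
    (hbound₁ : Boltzmann.KernelBound Ω B₁) (hbound₂ : Boltzmann.KernelBound Ω B₂)
    (hmeas : Boltzmann.SameMeasurements Ω B₁ B₂)
    (hsign : ∀ v u, B₁ v u ≤ B₂ v u ∨ B₂ v u ≤ B₁ v u) : B₁ = B₂ := by
  obtain ⟨M₁, hB₁⟩ := hbound₁.exists_isAdmissibleKernel hΩ.isOpen hΩ.isConnected.nonempty hcont₁
  obtain ⟨M₂, hB₂⟩ := hbound₂.exists_isAdmissibleKernel hΩ.isOpen hΩ.isConnected.nonempty hcont₂
  refine hcont₁.eq_of_forall_ne_zero (by omega) hcont₂ fun v hv => funext fun u => ?_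
  have hint := hmeas.integral_sphere_eq hn hΩ hB₁ hB₂ hv u
  rcases hsign v u with hle | hle
  · exact hcont₁.eq_of_le_of_integral_sphere_eq hcont₂ hle hint
  · exact (hcont₂.eq_of_le_of_integral_sphere_eq hcont₁ hle hint.symm).symm

theorem corollary1p3 (n : ℕ) (hn : 2 ≤ n) (Ω : Set (Boltzmann.Space n))
    (hΩ : Boltzmann.IsSmoothBoundedDomain Ω) (B₁ B₂ : Boltzmann.Kernel n)
    (hcont₁ : Boltzmann.IsContinuousKernel B₁) (hcont₂ : Boltzmann.IsContinuousKernel B₂)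
    (hbound₁ : Boltzmann.KernelBound Ω B₁) (hbound₂ : Boltzmann.KernelBound Ω B₂)
    (hsymm₁ : Boltzmann.KernelSymmetric B₁) (hsymm₂ : Boltzmann.KernelSymmetric B₂)
    (hmeas : Boltzmann.SameMeasurements Ω B₁ B₂) :
    (Boltzmann.IndependentOfAngle B₁ → Boltzmann.IndependentOfAngle B₂ → B₁ = B₂) ∧
    ((∀ v u ω, B₂ v u ω ≤ B₁ v u ω) → B₁ = B₂) := by
  have hgeneral := corollary1p3_general n hn Ω hΩ B₁ B₂ hcont₁ hcont₂ hbound₁ hbound₂ hmeas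
  refine ⟨fun hind₁ hind₂ => hgeneral fun v u => or_iff_not_imp_left.2 fun hnot ω => ?_,
    fun hle => hgeneral fun v u => Or.inr (hle v u)⟩
  obtain ⟨ω', hω'⟩ := not_forall.1 hnot
  rw [hind₁ v u ω ω', hind₂ v u ω ω']
  exact (not_le.1 hω').le
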